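/- **Setting.** Let $k$ be an algebraically closed field; coalgebras are coassociative, counital and cocommutative over $k$. For a vector space $V$ let ${!}V$ be the cofree coalgebra over $V$, with universal linear map $d:{!}V\to V$; for $P\in V$ let $\ket{\emptyset}_P\in{!}V$ (the vacuum vector at $P$) be the image of $1$ under the unique coalgebra morphism $k\to{!}V$ whose composite with $d$ is $1\mapsto P$. Formulas of first-order intuitionistic linear logic are built from atoms with $\otimes,\&,\multimap,{!}$. In the Sweedler semantics $⟦-⟧$ the atoms denote arbitrary $k$-vector spaces, $⟦A\otimes B⟧=⟦A⟧\otimes⟦B⟧$, $⟦A\& B⟧=⟦A⟧\oplus⟦B⟧$, $⟦A\multimap B⟧=\operatorname{Hom}_k(⟦A⟧,⟦B⟧)$, $⟦{!}A⟧={!}⟦A⟧$, and a proof of $A_1,\dots,A_m\vdash B$ denotes a linear map $⟦A_1⟧\otimes\cdots\otimes⟦A_m⟧\to⟦B⟧$ (promotion by the universal property of ${!}$; dereliction, contraction, weakening by $d$, the comultiplication and the counit). **Encodings.** For a formula $A$ write $A^m=A\&\cdots\& A$, $E=A\multimap A$, ${}_m\mathbf{bool}_A=A^m\multimap A$, $\mathbf{bool}_A={}_2\mathbf{bool}_A$,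 $\mathbf{bint}_A={!}E\multimap({!}E\multimap E)$ and $\mathbf{Tur}_A={!}\mathbf{bint}_A\otimes{!}\mathbf{bint}_A\otimes{!}\,{}_n\mathbf{bool}_A$. The proof $\underline i$ of $\vdash{}_m\mathbf{bool}_A$ ($0\le i<m$) is the $i$-th projection. For $S=s_1\cdots s_l\in\{0,1\}^*$, $\underline S$ is the proof of $\vdash\mathbf{bint}_A$ which applies one copy of its first argument for every digit $0$ and one copy of its second argument for every digit $1$, the digit $s_1$ first (by derelictions, contractions and weakenings); so $⟦\underline S⟧(\ket{\emptyset}_{f_0}\otimes\ket{\emptyset}_{f_1})=f_{s_l}\circ\cdots\circ f_{s_1}$. Let $Q=\{0,\dots,n-1\}$ with $n\ge1$, $\Sigma=\{0,1\}$, and let $\delta:\Sigma\times Q\to\Sigma\times Q\times\{\text{left},\text{right}\}$ be any function, with components $\delta_0,\delta_1,\delta_2$; identify $\text{left}=0$, $\text{right}=1$. The following proofs are used. * $\underline{\mathrm{head}}_A:\mathbf{bint}_{A^3}\vdash\mathbf{bool}_A$ evaluates its argument on the promotions of the endomorphisms $(x,y,z)\mapsto(x,y,x)$ and $(x,y,z)\mapsto(x,y,y)$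 of $A^3$, precomposes with $A^2\to A^3$, $(x,y)\mapsto(x,y,x)$, and postcomposes with the last projection; it sends $⟦\underline{S\sigma}⟧$ to $⟦\underline\sigma⟧$. * $\underline{\mathrm{tail}}_A:\mathbf{bint}_{A^3}\vdash\mathbf{bint}_A$ precomposes both arguments with the promotion of the proof of ${!}E\vdash A^3\multimap A^3$ that sends $\ket{\emptyset}_g$ to $(x,y,z)\mapsto(z,z,g(z))$, and then sends $\varphi\in\operatorname{End}(⟦A^3⟧)$ to $a\mapsto\operatorname{pr}_0\varphi(a,a,a)$; it sends $⟦\underline{S\sigma}⟧$ to $⟦\underline S⟧$. * ${}_n\underline{\mathrm{booltype}}_A:{}_n\mathbf{bool}_{A^3}\vdash{}_n\mathbf{bool}_A$ sends $\psi$ to $(a_0,\dots,a_{n-1})\mapsto\operatorname{pr}_0\psi((a_0,a_0,a_0),\dots,(a_{n-1},a_{n-1},a_{n-1}))$. * ${}^i_\delta\underline{\mathrm{trans}}_A:\mathbf{bool}_A,{}_n\mathbf{bool}_A\vdash{}_m\mathbf{bool}_A$ ($m=n$ if $i=1$, otherwise $m=2$) sends $\psi\otimes\varphi$ to $(a_u)_{u<m}\mapsto\psi\big(\varphi((a_{\delta_i(0,v)})_{v<n}),\varphi((a_{\delta_i(1,v)})_{v<n})\big)$.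 * ${}^0\underline{\mathrm{recomb}}_A,{}^1\underline{\mathrm{recomb}}_A:\mathbf{bint}_A,3\,\mathbf{bool}_A\vdash\mathbf{bint}_A$ use the three booleans to select, by $\&R$ and $\multimap L$, a fixed word to be concatenated on the right of the binary integer; they encode $(S,\tau,\sigma,d)\mapsto S$ if $d=0$, $S\sigma\tau$ if $d=1$, respectively $(T,\tau,\sigma,d)\mapsto T\tau\sigma$ if $d=0$, $T$ if $d=1$. * ${}_\delta\underline{\mathrm{left}}_A:3\,\mathbf{bint}_{A^3},\mathbf{bint}_{A^3},2\,{}_n\mathbf{bool}_{A^3}\vdash\mathbf{bint}_A$ is the composite, by cuts, of $\underline{\mathrm{tail}}\otimes\underline{\mathrm{head}}^{\otimes3}\otimes\underline{\mathrm{booltype}}^{\otimes2}$, the exchange $S,\sigma_1,\sigma_2,\tau,q_1,q_2\mapsto S,\tau,\sigma_1,q_1,\sigma_2,q_2$, $\mathrm{id}^{\otimes2}\otimes{}^0_\delta\underline{\mathrm{trans}}\otimes{}^2_\delta\underline{\mathrm{trans}}$, and ${}^0\underline{\mathrm{recomb}}$. * ${}_\delta\underline{\mathrm{right}}_A:2\,\mathbf{bint}_{A^3},2\,\mathbf{bint}_{A^3},2\,{}_n\mathbf{bool}_{A^3}\vdash\mathbf{bint}_A$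 is the composite of $\underline{\mathrm{head}}^{\otimes3}\otimes\underline{\mathrm{tail}}\otimes\underline{\mathrm{booltype}}^{\otimes2}$, the exchange $\sigma_1,\sigma_2,\tau,T,q_1,q_2\mapsto T,\tau,\sigma_1,q_1,\sigma_2,q_2$, $\mathrm{id}^{\otimes2}\otimes{}^0_\delta\underline{\mathrm{trans}}\otimes{}^2_\delta\underline{\mathrm{trans}}$, and ${}^1\underline{\mathrm{recomb}}$. * ${}_\delta\underline{\mathrm{state}}_A:\mathbf{bint}_{A^3},{}_n\mathbf{bool}_{A^3}\vdash{}_n\mathbf{bool}_A$ is the composite of $\underline{\mathrm{head}}\otimes\underline{\mathrm{booltype}}$ and ${}^1_\delta\underline{\mathrm{trans}}$. * ${}_\delta\underline{\mathrm{step}}_A:\mathbf{Tur}_{A^3}\vdash\mathbf{Tur}_A$ is obtained from these three by dereliction on all inputs and promotion, then $\otimes R$ twice, and then contraction of the $6$ copies of the first, the $3$ copies of the second and the $5$ copies of the third input. **Lemma.** Let $a_i\in k$, $S_i\in\Sigma^*$, $\sigma_i\in\Sigma$ ($1\le i\le s$), $b_i\in k$, $T_i\in\Sigma^*$, $\tau_i\in\Sigma$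 ($1\le i\le t$), $c_i\in k$, $q_i\in Q$ ($1\le i\le r$), and put $$\alpha=\sum_{i=1}^s a_i⟦\underline{S_i\sigma_i}⟧,\quad \beta=\sum_{i=1}^t b_i⟦\underline{T_i\tau_i}⟧\ \in⟦\mathbf{bint}_{A^3}⟧,\qquad \gamma=\sum_{i=1}^r c_i⟦\underline{q_i}⟧\in⟦{}_n\mathbf{bool}_{A^3}⟧ .$$ Write $(\hat\sigma_i^j,\hat q_i^j,\hat d_i^j)=\delta(\sigma_i,q_j)$, and let $\delta_{\hat d_i^j=e}$ be $1$ if $\hat d_i^j=e$ and $0$ otherwise. Then: 1. $⟦{}_\delta\underline{\mathrm{left}}_A⟧(\alpha^{\otimes3}\otimes\beta\otimes\gamma^{\otimes2})=L$, where $$L=\Big(\sum_{i=1}^s\sum_{j=1}^r a_ic_j\delta_{\hat d_i^j=0}\Big)\Big(\sum_{i=1}^s a_i\Big)\Big(\sum_{i=1}^t b_i\Big)\Big(\sum_{i=1}^r c_i\Big)\Big(\sum_{i=1}^s a_i⟦\underline{S_i}⟧\Big)+\Big(\sum_{i=1}^s\sum_{j=1}^r a_ic_j\delta_{\hat d_i^j=1}\Big)\Big(\sum_{i=1}^s\sum_{j=1}^s\sum_{m=1}^t\sum_{l=1}^r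 a_ia_jb_mc_l⟦\underline{S_i\hat\sigma_j^l\tau_m}⟧\Big)\in⟦\mathbf{bint}_A⟧ .$$ 2. $⟦{}_\delta\underline{\mathrm{right}}_A⟧(\alpha^{\otimes2}\otimes\beta^{\otimes2}\otimes\gamma^{\otimes2})=R$, where $$R=\Big(\sum_{i=1}^s\sum_{j=1}^r a_ic_j\delta_{\hat d_i^j=1}\Big)\Big(\sum_{i=1}^s a_i\Big)\Big(\sum_{i=1}^t b_i\Big)\Big(\sum_{i=1}^r c_i\Big)\Big(\sum_{i=1}^t b_i⟦\underline{T_i}⟧\Big)+\Big(\sum_{i=1}^s\sum_{j=1}^r a_ic_j\delta_{\hat d_i^j=0}\Big)\Big(\sum_{i=1}^t\sum_{j=1}^s\sum_{m=1}^t\sum_{l=1}^r b_ia_jb_mc_l⟦\underline{T_i\tau_m\hat\sigma_j^l}⟧\Big)\in⟦\mathbf{bint}_A⟧ .$$ 3. $⟦{}_\delta\underline{\mathrm{state}}_A⟧(\alpha\otimes\gamma)=U$, where $U=\sum_{i=1}^s\sum_{j=1}^r a_ic_j⟦\underline{\hat q_i^j}⟧\in⟦{}_n\mathbf{bool}_A⟧$.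 4. $⟦{}_\delta\underline{\mathrm{step}}_A⟧\big(\ket{\emptyset}_\alpha\otimes\ket{\emptyset}_\beta\otimes\ket{\emptyset}_\gamma\big)=\ket{\emptyset}_L\otimes\ket{\emptyset}_R\otimes\ket{\emptyset}_U$. -/

import Mathlib

open scoped TensorProduct

universe u v

noncomputable section

namespace Sweedler

/-! ### The cofree cocommutative coalgebra -/

namespace Cofree

variable {k : Type u} [Field k]

/-- Functionals that separate the points of `M` and of `N` separate the points of `M ⊗ N`. -/
theorem sep_tensor {M N A B : Type*} [AddCommGroup M] [Module k M] [AddCommGroup N] [Module k N]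
    (P : A → M →ₗ[k] k) (Q : B → N →ₗ[k] k)
    (hP : ∀ m, (∀ a, P a m = 0) → m = 0) (hQ : ∀ n, (∀ b, Q b n = 0) → n = 0)
    (w : M ⊗[k] N)
    (h : ∀ a b, LinearMap.mul' k k (TensorProduct.map (P a) (Q b) w) = 0) : w = 0 := by
  classical
  let bas := Module.Basis.ofVectorSpace k M
  let g : B → M ⊗[k] N →ₗ[k] M := fun b =>
    (TensorProduct.rid k M).toLinearMap ∘ₗ LinearMap.lTensor M (Q b)
  have hg : ∀ b, g b w = 0 := fun b => hP _ fun a => by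
    rw [← h a b]
    have : P a ∘ₗ g b = LinearMap.mul' k k ∘ₗ TensorProduct.map (P a) (Q b) := by
      ext m n; simp [g, mul_comm]
    exact congr($this w)
  apply (TensorProduct.equivFinsuppOfBasisLeft (N := N) bas).injective
  rw [map_zero]
  ext i
  apply hQ
  intro b
  have key : (Q b) ∘ₗ Finsupp.lapply i ∘ₗ
      (TensorProduct.equivFinsuppOfBasisLeft (N := N) bas).toLinearMap =
      bas.coord i ∘ₗ g b := by
    ext m n; simp [g, mul_comm]
  have := congr($key w)
  simpa [hg b] using this

/-- For a linear map `f : D → V` out of a coalgebra and a word `l₁ ⋯ lₙ` of functionals on `V`,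
the functional `x ↦ (l₁ f ⊗ ⋯ ⊗ lₙ f)(Δⁿ x)`, that is the convolution product of the `lᵢ ∘ f`. -/
def word {V D : Type u} [AddCommGroup V] [Module k V] [AddCommGroup D] [Module k D]
    [Coalgebra k D] (f : D →ₗ[k] V) (w : List (V →ₗ[k] k)) : D →ₗ[k] k :=
  (w.map fun l => WithConv.toConv (l ∘ₗ f)).prod.ofConv

section word

variable {V D : Type u} [AddCommGroup V] [Module k V] [AddCommGroup D] [Module k D]
    [Coalgebra k D] (f : D →ₗ[k] V)

theorem word_append (a b : List (V →ₗ[k] k)) (x : D) :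
    word f (a ++ b) x =
      LinearMap.mul' k k (TensorProduct.map (word f a) (word f b) (Coalgebra.comul x)) := by
  simp only [word, List.map_append, List.prod_append]; rfl

theorem word_nil (x : D) : word f [] x = Coalgebra.counit (R := k) x := by
  simp only [word, List.map_nil, List.prod_nil]; rfl

theorem word_singleton (l : V →ₗ[k] k) (x : D) : word f [l] x = l (f x) := by
  simp [word]

theorem word_comm [Coalgebra.IsCocomm k D] (a b : List (V →ₗ[k] k)) (x : D) :
    word f (a ++ b) x = word f (b ++ a) x := by
  simp only [word, List.map_append, List.prod_append]
  rw [mul_comm]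

theorem word_comp {C : Type u} [AddCommGroup C] [Module k C] [Coalgebra k C] (F : C →ₗc[k] D)
    (w : List (V →ₗ[k] k)) (x : C) :
    word (f ∘ₗ F.toLinearMap) w x = word f w (F x) := by
  induction w generalizing x with
  | nil => simp [word_nil]
  | cons l w ih =>
    have h1 : word (f ∘ₗ F.toLinearMap) w = word f w ∘ₗ F.toLinearMap := LinearMap.ext ih
    have h2 : word (f ∘ₗ F.toLinearMap) [l] = word f [l] ∘ₗ F.toLinearMap :=
      LinearMap.ext fun x => by rw [word_singleton]; simp [word_singleton]
    rw [← List.singleton_append, word_append, word_append, h1, h2, TensorProduct.map_comp,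
      LinearMap.comp_apply, ← CoalgHomClass.map_comp_comul_apply F x]
    rfl

end word

/-- The underlying space of the cofree cocommutative coalgebra on `V`: the functions on words of
functionals on `V` spanned by the functions `w ↦ word f w x`, for `x` an element of a
cocommutative coalgebra `D` and `f : D → V` linear. -/
def space (k V : Type u) [Field k] [AddCommGroup V] [Module k V] :
    Submodule k (List (V →ₗ[k] k) → k) :=
  Submodule.span k {t | ∃ (D : Type u) (_ : AddCommGroup D) (_ : Module k D) (_ : Coalgebra k D)
    (_ : Coalgebra.IsCocomm k D) (f : D →ₗ[k] V) (x : D), t = fun w => word f w x}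

end Cofree

/-- The cofree (universal) cocommutative coassociative counital coalgebra `!V` on the vector
space `V`. Its structure is given below, and its universal property is `Cofree.existsUnique`. -/
def Cofree (k V : Type u) [Field k] [AddCommGroup V] [Module k V] : Type u := Cofree.space k V

namespace Cofree

variable (k V : Type u) [Field k] [AddCommGroup V] [Module k V]

instance : AddCommGroup (Cofree k V) := inferInstanceAs (AddCommGroup (Cofree.space k V))
instance : Module k (Cofree k V) := inferInstanceAs (Module k (Cofree.space k V))

variable {V}

/-- Evaluation of an element of `!V` at a word of functionals. -/
def ev (w : List (V →ₗ[k] k)) : Cofree k V →ₗ[k] k :=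
  LinearMap.proj w ∘ₗ (Cofree.space k V).subtype

variable {k}

theorem ext_ev {s t : Cofree k V} (h : ∀ w, ev k w s = ev k w t) : s = t :=
  Subtype.ext (funext h)

theorem sep_ev (t : Cofree k V) (h : ∀ w, ev k w t = 0) : t = 0 :=
  ext_ev fun w => by rw [h w, map_zero]

/-- The linear map `D → !V` induced by `f : D → V`. -/
def liftLin {D : Type u} [AddCommGroup D] [Module k D] [Coalgebra k D] [Coalgebra.IsCocomm k D]
    (f : D →ₗ[k] V) : D →ₗ[k] Cofree k V :=
  LinearMap.codRestrict (Cofree.space k V) (LinearMap.pi fun w => word f w) fun x =>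
    Submodule.subset_span ⟨D, _, _, _, inferInstance, f, x, rfl⟩

theorem ev_liftLin {D : Type u} [AddCommGroup D] [Module k D] [Coalgebra k D]
    [Coalgebra.IsCocomm k D] (f : D →ₗ[k] V) (w : List (V →ₗ[k] k)) (x : D) :
    ev k w (liftLin f x) = word f w x := rfl

theorem ind {p : Cofree k V → Prop}
    (lift : ∀ (D : Type u) [AddCommGroup D] [Module k D] [Coalgebra k D]
      [Coalgebra.IsCocomm k D] (f : D →ₗ[k] V) (x : D), p (liftLin f x))
    (zero : p 0) (add : ∀ s t, p s → p t → p (s + t)) (smul : ∀ (c : k) t, p t → p (c • t))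
    (t : Cofree k V) : p t := by
  obtain ⟨t, ht⟩ := t
  induction ht using Submodule.span_induction with
  | mem t h => obtain ⟨D, i1, i2, i3, i4, f, x, rfl⟩ := h; exact lift D f x
  | zero => exact zero
  | add s t hs ht h1 h2 => exact add _ _ h1 h2
  | smul c t ht h => exact smul c _ h

/-- Evaluation of an element of `!V ⊗ !V` at a pair of words. -/
def ev₂ (a b : List (V →ₗ[k] k)) : Cofree k V ⊗[k] Cofree k V →ₗ[k] k :=
  LinearMap.mul' k k ∘ₗ TensorProduct.map (ev k a) (ev k b)

theorem sep_ev₂ (t : Cofree k V ⊗[k] Cofree k V) (h : ∀ a b, ev₂ a b t = 0) : t = 0 :=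
  sep_tensor (ev k) (ev k) sep_ev sep_ev t h

theorem ext_ev₂ {s t : Cofree k V ⊗[k] Cofree k V} (h : ∀ a b, ev₂ a b s = ev₂ a b t) : s = t :=
  sub_eq_zero.1 (sep_ev₂ _ fun a b => by rw [map_sub, h, sub_self])

theorem ev₂_map_liftLin {D : Type u} [AddCommGroup D] [Module k D] [Coalgebra k D]
    [Coalgebra.IsCocomm k D] (f : D →ₗ[k] V) (a b : List (V →ₗ[k] k)) (x : D) :
    ev₂ a b (TensorProduct.map (liftLin f) (liftLin f) (Coalgebra.comul x)) =
      ev k (a ++ b) (liftLin f x) := by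
  rw [ev_liftLin, word_append, ev₂, LinearMap.comp_apply,
    ← LinearMap.comp_apply (TensorProduct.map (ev k a) (ev k b)), ← TensorProduct.map_comp]
  rfl

theorem exists_comul (t : Cofree k V) :
    ∃ w : Cofree k V ⊗[k] Cofree k V, ∀ a b, ev₂ a b w = ev k (a ++ b) t := by
  induction t using ind with
  | lift D f x => exact ⟨_, fun a b => ev₂_map_liftLin f a b x⟩
  | zero => exact ⟨0, fun a b => by simp⟩
  | add s t hs ht =>
    obtain ⟨v, hv⟩ := hs
    obtain ⟨w, hw⟩ := ht
    exact ⟨v + w, fun a b => by rw [map_add, map_add, hv, hw]⟩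
  | smul c t ht =>
    obtain ⟨w, hw⟩ := ht
    exact ⟨c • w, fun a b => by rw [map_smul, map_smul, hw]⟩

theorem exists_counit (t : Cofree k V) : ∃ v : V, ∀ l : V →ₗ[k] k, l v = ev k [l] t := by
  induction t using ind with
  | lift D f x => exact ⟨f x, fun l => by rw [ev_liftLin, word_singleton]⟩
  | zero => exact ⟨0, fun a => by simp⟩
  | add s t hs ht =>
    obtain ⟨v, hv⟩ := hs
    obtain ⟨w, hw⟩ := ht
    exact ⟨v + w, fun a => by rw [map_add, map_add, hv, hw]⟩
  | smul c t ht =>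
    obtain ⟨w, hw⟩ := ht
    exact ⟨c • w, fun a => by rw [map_smul, map_smul, hw]⟩

theorem ext_dual {v w : V} (h : ∀ l : V →ₗ[k] k, l v = l w) : v = w :=
  sub_eq_zero.1 ((Module.forall_dual_apply_eq_zero_iff k _).1 fun l => by
    rw [map_sub, h, sub_self])

theorem comul_choose (t : Cofree k V) (a b : List (V →ₗ[k] k)) :
    ev₂ a b (exists_comul t).choose = ev k (a ++ b) t := (exists_comul t).choose_spec a b

theorem counit_choose (t : Cofree k V) (l : V →ₗ[k] k) :
    l (exists_counit t).choose = ev k [l] t := (exists_counit t).choose_spec l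

/-- The comultiplication of `!V`, dual to concatenation of words. -/
def comulLin : Cofree k V →ₗ[k] Cofree k V ⊗[k] Cofree k V where
  toFun t := (exists_comul t).choose
  map_add' s t := ext_ev₂ fun a b => by
    rw [map_add, comul_choose, comul_choose, comul_choose, map_add]
  map_smul' c t := ext_ev₂ fun a b => by
    rw [map_smul, comul_choose, comul_choose, map_smul, RingHom.id_apply]

theorem ev₂_comulLin (t : Cofree k V) (a b : List (V →ₗ[k] k)) :
    ev₂ a b (comulLin t) = ev k (a ++ b) t := (exists_comul t).choose_spec a b

/-- The universal linear map `d : !V → V`. -/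
def d : Cofree k V →ₗ[k] V where
  toFun t := (exists_counit t).choose
  map_add' s t := ext_dual (k := k) fun l => by
    rw [map_add, counit_choose, counit_choose, counit_choose, map_add]
  map_smul' c t := ext_dual (k := k) fun l => by
    rw [map_smul, counit_choose, counit_choose, map_smul, RingHom.id_apply]

theorem apply_d (t : Cofree k V) (l : V →ₗ[k] k) : l (d t) = ev k [l] t :=
  (exists_counit t).choose_spec l

instance : Coalgebra k (Cofree k V) where
  comul := comulLin
  counit := ev k []
  coassoc := by
    ext t
    refine sub_eq_zero.1 (sep_tensor (ev k) (fun p : List (V →ₗ[k] k) × List (V →ₗ[k] k) =>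
      ev₂ p.1 p.2) sep_ev (fun n h => sep_ev₂ n fun a b => h (a, b)) _ ?_)
    rintro a ⟨b, c⟩
    rw [map_sub, map_sub, sub_eq_zero]
    have h1 : LinearMap.mul' k k ∘ₗ TensorProduct.map (ev k a) (ev₂ b c) ∘ₗ
        (TensorProduct.assoc k (Cofree k V) (Cofree k V) (Cofree k V)).toLinearMap =
        LinearMap.mul' k k ∘ₗ TensorProduct.map (ev₂ a b) (ev k c) := by
      ext x y z; simp [ev₂, mul_assoc]
    have h2 : ∀ a b : List (V →ₗ[k] k), ev₂ a b ∘ₗ comulLin = ev k (a ++ b) :=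
      fun a b => LinearMap.ext fun t => ev₂_comulLin t a b
    calc _ = (LinearMap.mul' k k ∘ₗ TensorProduct.map (ev₂ a b) (ev k c))
            (comulLin.rTensor (Cofree k V) (comulLin t)) := by rw [← h1]; rfl
      _ = ev₂ (a ++ b) c (comulLin t) := by
        rw [LinearMap.comp_apply, LinearMap.rTensor,
          ← LinearMap.comp_apply (TensorProduct.map (ev₂ a b) (ev k c)),
          ← TensorProduct.map_comp, h2]; rfl
      _ = ev₂ a (b ++ c) (comulLin t) := by
        rw [ev₂_comulLin, ev₂_comulLin, List.append_assoc]
      _ = _ := by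
        rw [LinearMap.comp_apply, LinearMap.lTensor,
          ← LinearMap.comp_apply (TensorProduct.map (ev k a) (ev₂ b c)),
          ← TensorProduct.map_comp, h2]; rfl
  rTensor_counit_comp_comul := by
    ext t
    apply (TensorProduct.lid k (Cofree k V)).injective
    refine ext_ev fun b => ?_
    have h : ev k b ∘ₗ (TensorProduct.lid k (Cofree k V)).toLinearMap ∘ₗ
        (ev k []).rTensor (Cofree k V) = ev₂ [] b := by
      ext x y; simp [ev₂]
    have := congr($h (comulLin t))
    rw [ev₂_comulLin] at this
    simpa using this
  lTensor_counit_comp_comul := by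
    ext t
    apply (TensorProduct.rid k (Cofree k V)).injective
    refine ext_ev fun b => ?_
    have h : ev k b ∘ₗ (TensorProduct.rid k (Cofree k V)).toLinearMap ∘ₗ
        (ev k []).lTensor (Cofree k V) = ev₂ b [] := by
      ext x y; simp [ev₂, mul_comm]
    have := congr($h (comulLin t))
    rw [ev₂_comulLin, List.append_nil] at this
    simpa using this

instance : Coalgebra.IsCocomm k (Cofree k V) where
  comm_comp_comul := by
    ext t
    refine ext_ev₂ fun a b => ?_
    have h : ev₂ a b ∘ₗ (TensorProduct.comm k (Cofree k V) (Cofree k V)).toLinearMap =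
        ev₂ b a := by
      ext x y; simp [ev₂, mul_comm]
    have h2 : ev k (b ++ a) t = ev k (a ++ b) t := by
      induction t using ind with
      | lift D f x => exact word_comm f b a x
      | zero => simp
      | add s t hs ht => rw [map_add, map_add, hs, ht]
      | smul c t ht => rw [map_smul, map_smul, ht]
    calc _ = ev₂ b a (comulLin t) := congr($h (comulLin t))
      _ = ev₂ a b (comulLin t) := by rw [ev₂_comulLin, ev₂_comulLin, h2]
      _ = _ := rfl

section lift

variable {D : Type u} [AddCommGroup D] [Module k D] [Coalgebra k D] [Coalgebra.IsCocomm k D]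

/-- The coalgebra morphism `D → !V` lifting a linear map `f : D → V`. -/
def lift (f : D →ₗ[k] V) : D →ₗc[k] Cofree k V where
  toLinearMap := liftLin f
  counit_comp := LinearMap.ext fun x => word_nil f x
  map_comp_comul := LinearMap.ext fun x => ext_ev₂ fun a b =>
    (ev₂_map_liftLin f a b x).trans (ev₂_comulLin _ a b).symm

theorem d_lift (f : D →ₗ[k] V) : d ∘ₗ (lift f).toLinearMap = f :=
  LinearMap.ext fun x => ext_dual fun l => by
    rw [LinearMap.comp_apply, apply_d]
    exact word_singleton f l x

theorem word_d (w : List (V →ₗ[k] k)) (t : Cofree k V) : word d w t = ev k w t := by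
  induction w generalizing t with
  | nil => exact word_nil _ _
  | cons l w ih =>
    have h1 : word d w = ev k w := LinearMap.ext ih
    have h2 : word d [l] = ev k [l] := LinearMap.ext fun t => by
      rw [word_singleton, apply_d]
    rw [← List.singleton_append, word_append, h1, h2]
    exact ev₂_comulLin t [l] w

/-- The universal property of `d : !V → V`. -/
theorem existsUnique (f : D →ₗ[k] V) : ∃! F : D →ₗc[k] Cofree k V, d ∘ₗ F.toLinearMap = f := by
  refine ⟨lift f, d_lift f, fun F hF => ?_⟩
  ext x
  refine ext_ev fun w => ?_
  rw [← word_d, ← word_comp, hF]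
  rfl

end lift

/-- The vacuum vector `|∅⟩_P`: the image of `1` under the coalgebra morphism `k → !V` lifting the
linear map `k → V`, `1 ↦ P`. -/
def vac (P : V) : Cofree k V := lift (LinearMap.toSpanSingleton k V P) (1 : k)

end Cofree

/-- Formulas of (first-order, intuitionistic) linear logic over a set `At` of atomic formulas. -/
inductive Formula (At : Type v) : Type v
  | atom : At → Formula At
  | tensor : Formula At → Formula At → Formula At
  | amp : Formula At → Formula At → Formula At
  | lolli : Formula At → Formula At → Formula At
  | bang : Formula At → Formula At

open Formula

/-- Proofs of sequents `Γ ⊢ A` of linear logic. In the left rules `Υ` is the part of the context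
on the left of the principal formula. -/
inductive Prf {At : Type v} : List (Formula At) → Formula At → Type v
  /-- axiom -/
  | ax (A) : Prf [A] A
  /-- exchange: moves the formula `A` to the left of the block `Γ` -/
  | exch (Υ Γ) {A Δ C} : Prf (Υ ++ (Γ ++ A :: Δ)) C → Prf (Υ ++ (A :: (Γ ++ Δ))) C
  | cut (Υ) {Γ Δ A C} : Prf Γ A → Prf (Υ ++ A :: Δ) C → Prf (Υ ++ (Γ ++ Δ)) C
  | tensorR {Γ Δ A B} : Prf Γ A → Prf Δ B → Prf (Γ ++ Δ) (tensor A B)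
  | tensorL (Υ) {Δ A B C} : Prf (Υ ++ A :: B :: Δ) C → Prf (Υ ++ tensor A B :: Δ) C
  | ampR {Γ A B} : Prf Γ A → Prf Γ B → Prf Γ (amp A B)
  | ampL₀ (Υ) {Δ A B C} : Prf (Υ ++ A :: Δ) C → Prf (Υ ++ amp A B :: Δ) C
  | ampL₁ (Υ) {Δ A B C} : Prf (Υ ++ B :: Δ) C → Prf (Υ ++ amp A B :: Δ) C
  | lolliR {Γ A B} : Prf (A :: Γ) B → Prf Γ (lolli A B)
  | lolliL (Υ) {Γ Δ A B C} :
      Prf Γ A → Prf (Υ ++ B :: Δ) C → Prf (Υ ++ lolli A B :: (Γ ++ Δ)) C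
  /-- promotion -/
  | prom (Γ : List (Formula At)) {A} : Prf (Γ.map bang) A → Prf (Γ.map bang) (bang A)
  /-- dereliction -/
  | der (Υ) {Δ A C} : Prf (Υ ++ A :: Δ) C → Prf (Υ ++ bang A :: Δ) C
  /-- contraction -/
  | ctr (Υ) {Δ A C} : Prf (Υ ++ bang A :: bang A :: Δ) C → Prf (Υ ++ bang A :: Δ) C
  /-- weakening -/
  | weak (Υ) {Δ A C} : Prf (Υ ++ Δ) C → Prf (Υ ++ bang A :: Δ) C

/-! ### The Sweedler semantics -/

section Semantics

variable {k : Type u} [Field k] {At : Type v} (I : At → ModuleCat.{u} k)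

/-- The denotation of a formula, given the vector spaces that interpret the atoms. -/
def den : Formula At → ModuleCat.{u} k
  | .atom x => I x
  | .tensor A B => ModuleCat.of k (den A ⊗[k] den B)
  | .amp A B => ModuleCat.of k (den A × den B)
  | .lolli A B => ModuleCat.of k (den A →ₗ[k] den B)
  | .bang A => ModuleCat.of k (Cofree k (den A))

/-- The denotation `A₁ ⊗ (A₂ ⊗ ⋯ (Aᵣ ⊗ k))` of a context. -/
def ctx : List (Formula At) → ModuleCat.{u} k
  | [] => ModuleCat.of k k
  | A :: Γ => ModuleCat.of k (den I A ⊗[k] ctx Γ)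

/-- The canonical isomorphism between the denotation of `Γ, Δ` and the tensor product. -/
def split : (Γ Δ : List (Formula At)) → (ctx I (Γ ++ Δ) →ₗ[k] ctx I Γ ⊗[k] ctx I Δ)
  | [], Δ => (TensorProduct.lid k (ctx I Δ)).symm.toLinearMap
  | A :: Γ, Δ =>
    (TensorProduct.assoc k (den I A) (ctx I Γ) (ctx I Δ)).symm.toLinearMap ∘ₗ
      LinearMap.lTensor (den I A) (split Γ Δ)

/-- Apply a linear map to the part of a context that comes after `Υ`. -/
def under {Γ Δ : List (Formula At)} (f : ctx I Γ →ₗ[k] ctx I Δ) :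
    (Υ : List (Formula At)) → (ctx I (Υ ++ Γ) →ₗ[k] ctx I (Υ ++ Δ))
  | [] => f
  | A :: Υ => LinearMap.lTensor (den I A) (under f Υ)

/-- The canonical isomorphism that moves the first factor past `Γ`. -/
def move (A : Formula At) :
    (Γ Δ : List (Formula At)) → (ctx I (A :: (Γ ++ Δ)) →ₗ[k] ctx I (Γ ++ A :: Δ))
  | [], _ => LinearMap.id
  | B :: Γ, Δ => LinearMap.lTensor (den I B) (move A Γ Δ) ∘ₗ
      (TensorProduct.leftComm k (den I A) (den I B) (ctx I (Γ ++ Δ))).toLinearMap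

/-- The tensor product coalgebra structure on the denotation of `!Γ`. -/
instance ctxCoalgebra : (Γ : List (Formula At)) → Coalgebra k (ctx I (Γ.map bang))
  | [] => (inferInstance : Coalgebra k k)
  | A :: Γ =>
    letI := ctxCoalgebra Γ
    (inferInstance : Coalgebra k (Cofree k (den I A) ⊗[k] ctx I (Γ.map bang)))

instance ctxIsCocomm : (Γ : List (Formula At)) → Coalgebra.IsCocomm k (ctx I (Γ.map bang))
  | [] => (inferInstance : Coalgebra.IsCocomm k k)
  | A :: Γ =>
    letI := ctxIsCocomm Γ
    (inferInstance : Coalgebra.IsCocomm k (Cofree k (den I A) ⊗[k] ctx I (Γ.map bang)))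

/-- The denotation of a proof of `Γ ⊢ A`. -/
def denP : {Γ : List (Formula At)} → {A : Formula At} → Prf Γ A → (ctx I Γ →ₗ[k] den I A)
  | _, _, .ax A => (TensorProduct.rid k (den I A)).toLinearMap
  | _, _, .exch Υ Γ (A := A) (Δ := Δ) π => denP π ∘ₗ under I (move I A Γ Δ) Υ
  | _, _, .cut Υ (Γ := Γ) (Δ := Δ) (A := A) π ψ =>
      denP ψ ∘ₗ under I (Δ := A :: Δ) (LinearMap.rTensor (ctx I Δ) (denP π) ∘ₗ split I Γ Δ) Υ
  | _, _, .tensorR (Γ := Γ) (Δ := Δ) π ψ => TensorProduct.map (denP π) (denP ψ) ∘ₗ split I Γ Δ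
  | _, _, .tensorL Υ (Δ := Δ) (A := A) (B := B) π =>
      denP π ∘ₗ under I (Γ := A.tensor B :: Δ) (Δ := A :: B :: Δ)
        (TensorProduct.assoc k (den I A) (den I B) (ctx I Δ)).toLinearMap Υ
  | _, _, .ampR π ψ => LinearMap.prod (denP π) (denP ψ)
  | _, _, .ampL₀ Υ (Δ := Δ) (A := A) (B := B) π =>
      denP π ∘ₗ under I (Γ := A.amp B :: Δ) (Δ := A :: Δ)
        (LinearMap.rTensor (ctx I Δ) (LinearMap.fst k (den I A) (den I B))) Υ
  | _, _, .ampL₁ Υ (Δ := Δ) (A := A) (B := B) π =>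
      denP π ∘ₗ under I (Γ := A.amp B :: Δ) (Δ := B :: Δ)
        (LinearMap.rTensor (ctx I Δ) (LinearMap.snd k (den I A) (den I B))) Υ
  | _, _, .lolliR (Γ := Γ) (A := A) (B := B) π =>
      ((TensorProduct.mk k (den I A) (ctx I Γ)).compr₂
        (denP π : den I A ⊗[k] ctx I Γ →ₗ[k] den I B)).flip
  | _, _, .lolliL Υ (Γ := Γ) (Δ := Δ) (A := A) (B := B) π ψ =>
      denP ψ ∘ₗ under I (Γ := A.lolli B :: (Γ ++ Δ)) (Δ := B :: Δ)
        (LinearMap.rTensor (ctx I Δ)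
            (TensorProduct.lift (LinearMap.id : (den I A →ₗ[k] den I B) →ₗ[k] _)) ∘ₗ
          (TensorProduct.assoc k (den I A →ₗ[k] den I B) (den I A) (ctx I Δ)).symm.toLinearMap ∘ₗ
          LinearMap.lTensor (den I A →ₗ[k] den I B)
            (LinearMap.rTensor (ctx I Δ) (denP π) ∘ₗ split I Γ Δ)) Υ
  | _, _, .prom Γ (A := A) π =>
      (Cofree.lift (V := den I A) (D := ctx I (Γ.map bang)) (denP π)).toLinearMap
  | _, _, .der Υ (Δ := Δ) (A := A) π =>
      denP π ∘ₗ under I (Γ := A.bang :: Δ) (Δ := A :: Δ)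
        (LinearMap.rTensor (ctx I Δ) (Cofree.d (k := k) (V := den I A))) Υ
  | _, _, .ctr Υ (Δ := Δ) (A := A) π =>
      denP π ∘ₗ under I (Γ := A.bang :: Δ) (Δ := A.bang :: A.bang :: Δ)
        ((TensorProduct.assoc k (Cofree k (den I A)) (Cofree k (den I A)) (ctx I Δ)).toLinearMap ∘ₗ
          LinearMap.rTensor (ctx I Δ)
            (Coalgebra.comul : Cofree k (den I A) →ₗ[k] _ ⊗[k] _)) Υ
  | _, _, .weak Υ (Δ := Δ) (A := A) π =>
      denP π ∘ₗ under I (Γ := A.bang :: Δ) (Δ := Δ)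
        ((TensorProduct.lid k (ctx I Δ)).toLinearMap ∘ₗ
          LinearMap.rTensor (ctx I Δ) (Coalgebra.counit : Cofree k (den I A) →ₗ[k] k)) Υ

/-- The denotation of a proof of `⊢ A`, as an element of the denotation of `A`. -/
def elt {A : Formula At} (π : Prf [] A) : den I A := denP I π (show ctx I [] from (1 : k))

/-- The element `x ⊗ y` of the denotation of the context `A, Γ`. -/
def cons {A : Formula At} {Γ : List (Formula At)} (x : den I A) (y : ctx I Γ) : ctx I (A :: Γ) :=
  x ⊗ₜ[k] y

/-- The element `1` of the denotation `k` of the empty context. -/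
def nil : ctx I [] := (1 : k)

/-- The element `x ⊗ y` of the denotation of `A ⊗ B`. -/
def pair {A B : Formula At} (x : den I A) (y : den I B) : den I (tensor A B) := x ⊗ₜ[k] y

/-- The vacuum vector at `x`, as an element of the denotation of `!A`. -/
def vacuum {A : Formula At} (x : den I A) : den I (bang A) := Cofree.vac (k := k) (V := den I A) x

end Semantics

/-! ### Encodings of data as proofs -/

section Encodings

variable {At : Type v}

open Prf

/-- `pow A n` is `Aⁿ⁺¹ = A & ⋯ & A`, with `n + 1` factors. -/
def pow (A : Formula At) : ℕ → Formula At
  | 0 => A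
  | n + 1 => amp A (pow A n)

/-- The rule `&Lᵢ` for `Aⁿ⁺¹`. -/
def projL {A C : Formula At} {Γ : List (Formula At)} (π : Prf (A :: Γ) C) :
    (n : ℕ) → Fin (n + 1) → Prf (pow A n :: Γ) C
  | 0, _ => π
  | n + 1, i => Fin.cases (ampL₀ [] π) (fun j => ampL₁ [] (projL π n j)) i

/-- The iterated rule `&R` for `Aⁿ⁺¹`. -/
def tupleR {A : Formula At} {Γ : List (Formula At)} :
    (n : ℕ) → (Fin (n + 1) → Prf Γ A) → Prf Γ (pow A n)
  | 0, f => f 0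
  | n + 1, f => ampR (f 0) (tupleR n fun i => f i.succ)

/-- The type of `(n + 1)`-booleans. -/
abbrev nbool (A : Formula At) (n : ℕ) : Formula At := lolli (pow A n) A

/-- The type of booleans, `(A & A) ⊸ A`. -/
abbrev boolF (A : Formula At) : Formula At := nbool A 1

/-- The formula `A ⊸ A`. -/
abbrev endo (A : Formula At) : Formula At := lolli A A

/-- The type of binary integers, `!(A ⊸ A) ⊸ (!(A ⊸ A) ⊸ (A ⊸ A))`. -/
abbrev bint (A : Formula At) : Formula At :=
  lolli (bang (endo A)) (lolli (bang (endo A)) (endo A))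

/-- The formula `A³ = A & A & A`. -/
abbrev cube (A : Formula At) : Formula At := pow A 2

/-- The proof of the boolean `i`, for `0 ≤ i ≤ n`. -/
def nboolP (A : Formula At) (n : ℕ) (i : Fin (n + 1)) : Prf [] (nbool A n) :=
  lolliR (projL (ax A) n i)

/-- The proof of `A, A ⊸ A ⊢ A`. -/
def evalP (A : Formula At) : Prf [A, endo A] A :=
  exch [] [endo A] (Δ := []) (lolliL [] (Γ := [A]) (Δ := []) (ax A) (ax A))

/-- The binary integer `S` as a proof of `A, !(A ⊸ A), !(A ⊸ A) ⊢ A`: the first digit of `S`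
is applied first, by means of a dereliction of (a contracted copy of) the first `!(A ⊸ A)` for a
digit `0` and of the second one for a digit `1`. -/
def bintAux (A : Formula At) : List (Fin 2) → Prf [A, bang (endo A), bang (endo A)] A
  | [] => weak [A] (Δ := [bang (endo A)]) (weak [A] (Δ := []) (ax A))
  | σ :: S =>
    let E := bang (endo A)
    have π : Prf [A, E, E, E] A :=
      der [A] (Δ := [E, E]) (exch [] [endo A] (Δ := [E, E])
        (lolliL [] (Γ := [A]) (Δ := [E, E]) (ax A) (bintAux A S)))
    if σ = 0 then ctr [A] (Δ := [E]) π
    else ctr [A, E] (Δ := []) (exch [A] [E] (Δ := [E]) π)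

/-- The proof of the binary integer `S`. -/
def bintP (A : Formula At) (S : List (Fin 2)) : Prf [] (bint A) :=
  lolliR (lolliR (lolliR
    (exch [A] [bang (endo A)] (A := bang (endo A)) (Δ := []) (bintAux A S))))

/-! ### The encoding of the step function -/

/-- For `π₀, π₁ : A³ ⊢ A³`, the proof with denotation `(x₀, x₁, x₂) ↦ (x₀, x₁, xᵢ)`. -/
def headStep (A : Formula At) (i : Fin 3) : Prf [cube A] (cube A) :=
  tupleR 2 ![projL (ax A) 2 0, projL (ax A) 2 1, projL (ax A) 2 i]

/-- The proof of `A² ⊢ A³` with denotation `(x, y) ↦ (x, y, x)`. -/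
def headInit (A : Formula At) : Prf [pow A 1] (cube A) :=
  tupleR 2 ![projL (ax A) 1 0, projL (ax A) 1 1, projL (ax A) 1 0]

def headP (A : Formula At) : Prf [bint (cube A)] (boolF A) :=
  have h : Prf [endo (cube A)] (boolF A) :=
    lolliR (exch [] [endo (cube A)] (Δ := [])
      (lolliL [] (Γ := [pow A 1]) (Δ := []) (headInit A) (projL (ax A) 2 2)))
  lolliL [] (Γ := []) (Δ := []) (prom [] (lolliR (headStep A 0)))
    (lolliL [] (Γ := []) (Δ := []) (prom [] (lolliR (headStep A 1))) h)

/-- The proof `π` of `A³ ⊸ A³ ⊢ A ⊸ A` with denotation `φ ↦ (a ↦ (φ (a, a, a))₀)`. -/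
def tailOut (A : Formula At) : Prf [endo (cube A)] (endo A) :=
  lolliR (exch [] [endo (cube A)] (Δ := [])
    (lolliL [] (Γ := [A]) (Δ := []) (tupleR 2 fun _ => ax A) (projL (ax A) 2 0)))

/-- The proof `ρ` of `!(A ⊸ A) ⊢ A³ ⊸ A³`, which on a vacuum vector at `g` gives
`(x₀, x₁, x₂) ↦ (x₂, x₂, g x₂)`. -/
def tailStep (A : Formula At) : Prf [bang (endo A)] (endo (cube A)) :=
  have p : Prf [cube A, bang (endo A)] A := weak [cube A] (Δ := []) (projL (ax A) 2 2)
  have q : Prf [cube A, bang (endo A)] A :=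
    der [cube A] (Δ := []) (projL (evalP A) 2 2)
  lolliR (tupleR 2 ![p, p, q])

def tailP (A : Formula At) : Prf [bint (cube A)] (bint A) :=
  let E := bang (endo A)
  have ρ : Prf [E] (bang (endo (cube A))) := prom [endo A] (tailStep A)
  have h : Prf [bint (cube A), E, E] (endo A) :=
    lolliL [] (Γ := [E]) (Δ := [E]) ρ (lolliL [] (Γ := [E]) (Δ := []) ρ (tailOut A))
  have h' : Prf [E, E, bint (cube A)] (endo A) :=
    exch [] [E] (A := E) (Δ := [bint (cube A)])
      (exch [E] [bint (cube A)] (A := E) (Δ := [])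
        (exch [] [bint (cube A)] (A := E) (Δ := [E]) h))
  lolliR (lolliR h')

/-- The conversion of `(n + 1)`-booleans on `A³` to `(n + 1)`-booleans on `A`. -/
def booltypeP (A : Formula At) (n : ℕ) : Prf [nbool (cube A) n] (nbool A n) :=
  lolliR (exch [] [nbool (cube A) n] (Δ := [])
    (lolliL [] (Γ := [pow A n]) (Δ := [])
      (tupleR n fun i => tupleR 2 fun _ => projL (ax A) n i) (projL (ax A) 2 0)))

/-- The encoding of a function `{0, …, n} → {0, …, m}`, without the final rule `⊸R`. -/
def funP (A : Formula At) {n m : ℕ} (f : Fin (n + 1) → Fin (m + 1)) :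
    Prf [pow A m, nbool A n] A :=
  exch [] [nbool A n] (Δ := [])
    (lolliL [] (Γ := [pow A m]) (Δ := []) (tupleR n fun i => projL (ax A) m (f i)) (ax A))

/-- The encoding of a function `{0, 1} × {0, …, n} → {0, …, m}`. -/
def transP (A : Formula At) {n m : ℕ} (f : Fin 2 → Fin (n + 1) → Fin (m + 1)) :
    Prf [boolF A, nbool A n] (nbool A m) :=
  lolliR (exch [] [boolF A] (A := pow A m) (Δ := [nbool A n])
    (lolliL [] (Γ := [pow A m, nbool A n]) (Δ := []) (tupleR 1 fun j => funP A (f j)) (ax A)))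

/-- Composition, `A, A ⊸ A, A ⊸ A ⊢ A`; the first endomorphism is applied first. -/
def compP (A : Formula At) : Prf [A, endo A, endo A] A :=
  exch [] [endo A] (A := A) (Δ := [endo A])
    (lolliL [] (Γ := [A]) (Δ := [endo A]) (ax A) (evalP A))

def concatP (A : Formula At) : Prf [bint A, bint A] (bint A) :=
  let E := bang (endo A)
  let B := bint A
  have c : Prf [endo A, endo A] (endo A) := lolliR (compP A)
  have c₁ : Prf [endo A, B, E, E] (endo A) :=
    lolliL [endo A] (Γ := [E]) (Δ := [E]) (ax E)
      (lolliL [endo A] (Γ := [E]) (Δ := []) (ax E) c)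
  have c₂ : Prf [B, E, E, B, E, E] (endo A) :=
    lolliL [] (Γ := [E]) (Δ := [E, B, E, E]) (ax E)
      (lolliL [] (Γ := [E]) (Δ := [B, E, E]) (ax E) c₁)
  have c₃ : Prf [B, E, E, B, E] (endo A) :=
    ctr [B] (Δ := [E, B, E])
      (exch [B, E] [E, B] (A := E) (Δ := [E]) c₂)
  have c₄ : Prf [B, E, E, B] (endo A) :=
    ctr [B, E] (Δ := [B]) (exch [B, E, E] [B] (A := E) (Δ := []) c₃)
  have c₅ : Prf [E, E, B, B] (endo A) :=
    exch [E] [B] (A := E) (Δ := [B]) (exch [] [B, E] (A := E) (Δ := [B]) c₄)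
  lolliR (lolliR c₅)

/-- `concat(-, W)`: append the fixed binary integer `W`. -/
def appendP (A : Formula At) (W : List (Fin 2)) : Prf [bint A] (bint A) :=
  cut [bint A] (Γ := []) (Δ := []) (bintP A W) (concatP A)

/-- `concat(-, W)` without the final rules `⊸R`. -/
def appendOpen (A : Formula At) (W : List (Fin 2)) :
    Prf [bint A, bang (endo A), bang (endo A), A] A :=
  let E := bang (endo A)
  cut [] (Γ := [bint A]) (Δ := [E, E, A]) (appendP A W)
    (lolliL [] (Γ := [E]) (Δ := [E, A]) (ax E)
      (lolliL [] (Γ := [E]) (Δ := [A]) (ax E) (lolliL [] (Γ := [A]) (Δ := []) (ax A) (ax A))))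

/-- The encoding of `(S, σ, τ) ↦ S W_{στ}`, without the final rules `⊸R`; the booleans `σ, τ` come
first in the context. -/
def caseOpen (A : Formula At) (W : Fin 2 → Fin 2 → List (Fin 2)) :
    Prf [boolF A, boolF A, bint A, bang (endo A), bang (endo A), A] A :=
  let E := bang (endo A)
  lolliL [] (Γ := [boolF A, bint A, E, E, A]) (Δ := [])
    (tupleR 1 fun σ => lolliL [] (Γ := [bint A, E, E, A]) (Δ := [])
      (tupleR 1 fun τ => appendOpen A (W σ τ)) (ax A)) (ax A)

/-- The encoding of `(S, σ, τ, d) ↦ S (W d)_{στ}`. -/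
def recombP (A : Formula At) (W : Fin 2 → Fin 2 → Fin 2 → List (Fin 2)) :
    Prf [bint A, boolF A, boolF A, boolF A] (bint A) :=
  let E := bang (endo A)
  let B := boolF A
  have h : Prf [B, B, B, bint A, E, E, A] A :=
    lolliL [] (Γ := [B, B, bint A, E, E, A]) (Δ := [])
      (tupleR 1 fun d => caseOpen A (W d)) (ax A)
  have h₁ : Prf [A, B, B, B, bint A, E, E] A :=
    exch [] [B, B, B, bint A, E, E] (A := A) (Δ := []) h
  have h₂ : Prf [A, E, B, B, B, bint A, E] A :=
    exch [A] [B, B, B, bint A, E] (A := E) (Δ := []) h₁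
  have h₃ : Prf [A, E, E, B, B, B, bint A] A :=
    exch [A, E] [B, B, B, bint A] (A := E) (Δ := []) h₂
  have h₄ : Prf [A, E, E, bint A, B, B, B] A :=
    exch [A, E, E] [B, B, B] (A := bint A) (Δ := []) h₃
  have h₅ : Prf [A, E, E, bint A, B, B, B] A :=
    exch [A, E, E, bint A, B] [B] (A := B) (Δ := [])
      (exch [A, E, E, bint A] [B] (A := B) (Δ := [B]) h₄)
  lolliR (lolliR (lolliR h₅))

/-- `(S, τ, σ, d) ↦ S` if `d = 0` (left) and `S σ τ` if `d = 1` (right). -/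
def recomb₀ (A : Formula At) : Prf [bint A, boolF A, boolF A, boolF A] (bint A) :=
  recombP A fun d τ σ => if d = 0 then [] else [σ, τ]

/-- `(T, τ, σ, d) ↦ T τ σ` if `d = 0` (left) and `T` if `d = 1` (right). -/
def recomb₁ (A : Formula At) : Prf [bint A, boolF A, boolF A, boolF A] (bint A) :=
  recombP A fun d τ σ => if d = 0 then [τ, σ] else []

/-- The direction of a move of the head. -/
inductive Dir
  | left
  | right
  deriving DecidableEq

/-- The convention `left = 0`, `right = 1`. -/
def Dir.toFin : Dir → Fin 2
  | .left => 0
  | .right => 1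

/-- Transition functions of Turing machines with tape alphabet `{0, 1}` and set of states
`{0, …, n}`. -/
abbrev TransitionFunction (n : ℕ) : Type :=
  Fin 2 × Fin (n + 1) → Fin 2 × Fin (n + 1) × Dir

variable {n : ℕ} (δ : TransitionFunction n) (A : Formula At)

def trans₀ : Prf [boolF A, nbool A n] (boolF A) := transP A (m := 1) fun σ q => (δ (σ, q)).1

def trans₁ : Prf [boolF A, nbool A n] (nbool A n) := transP A fun σ q => (δ (σ, q)).2.1

def trans₂ : Prf [boolF A, nbool A n] (boolF A) :=
  transP A (m := 1) fun σ q => (δ (σ, q)).2.2.toFin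

/-- The common part of `left` and `right`: from `X, τ, σ, σ, q, q` (the tail of one half of the
tape, the symbol next to the head, two copies of the symbol under the head and of the state)
to `X, τ, σ', d`. -/
def middleP : Prf [bint A, boolF A, boolF A, nbool A n, boolF A, nbool A n]
    (tensor (bint A) (tensor (boolF A) (tensor (boolF A) (boolF A)))) :=
  tensorR (Γ := [bint A]) (ax _) (tensorR (Γ := [boolF A]) (ax _)
    (tensorR (Γ := [boolF A, nbool A n]) (Δ := [boolF A, nbool A n]) (trans₀ δ A) (trans₂ δ A)))

/-- A proof of `X, B, C, D ⊢ Y` as a proof of `X ⊗ B ⊗ C ⊗ D ⊢ Y`. -/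
def tensorL₄ {X B C D Y : Formula At} (π : Prf [X, B, C, D] Y) :
    Prf [tensor X (tensor B (tensor C D))] Y :=
  tensorL [] (Δ := []) (tensorL [X] (Δ := []) (tensorL [X, B] (Δ := []) π))

/-- A proof of `X, B, C, D, F, G ⊢ Y` as a proof of `X ⊗ B ⊗ C ⊗ D ⊗ F ⊗ G ⊢ Y`. -/
def tensorL₆ {X B C D F G Y : Formula At} (π : Prf [X, B, C, D, F, G] Y) :
    Prf [tensor X (tensor B (tensor C (tensor D (tensor F G))))] Y :=
  tensorL₄ (tensorL [X, B, C] (Δ := []) (tensorL [X, B, C, D] (Δ := []) π))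

/-- The proof `left` of `3 bint, bint, 2 nbool ⊢ bint`. -/
def leftP : Prf [bint (cube A), bint (cube A), bint (cube A), bint (cube A),
    nbool (cube A) n, nbool (cube A) n] (bint A) :=
  let B := bint (cube A)
  let N := nbool (cube A) n
  have first : Prf [B, B, B, B, N, N] (tensor (bint A) (tensor (boolF A) (tensor (boolF A)
      (tensor (boolF A) (tensor (nbool A n) (nbool A n)))))) :=
    tensorR (Γ := [B]) (tailP A) (tensorR (Γ := [B]) (headP A) (tensorR (Γ := [B]) (headP A)
      (tensorR (Γ := [B]) (headP A) (tensorR (Γ := [N]) (booltypeP A n) (booltypeP A n)))))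
  -- the exchange from `S, τ, σ₁, q₁, σ₂, q₂` to `S, σ₁, σ₂, τ, q₁, q₂`
  have second : Prf [bint A, boolF A, boolF A, boolF A, nbool A n, nbool A n]
      (tensor (bint A) (tensor (boolF A) (tensor (boolF A) (boolF A)))) :=
    exch [bint A, boolF A] [boolF A] (A := boolF A) (Δ := [nbool A n, nbool A n])
      (exch [bint A, boolF A, boolF A] [nbool A n] (A := boolF A) (Δ := [nbool A n])
        (exch [bint A] [boolF A] (A := boolF A) (Δ := [nbool A n, boolF A, nbool A n])
          (middleP δ A)))
  cut [] (Δ := []) (cut [] (Γ := [B, B, B, B, N, N]) (Δ := []) first (tensorL₆ second))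
    (tensorL₄ (recomb₀ A))

/-- The proof `right` of `2 bint, 2 bint, 2 nbool ⊢ bint`. -/
def rightP : Prf [bint (cube A), bint (cube A), bint (cube A), bint (cube A),
    nbool (cube A) n, nbool (cube A) n] (bint A) :=
  let B := bint (cube A)
  let N := nbool (cube A) n
  have first : Prf [B, B, B, B, N, N] (tensor (boolF A) (tensor (boolF A) (tensor (boolF A)
      (tensor (bint A) (tensor (nbool A n) (nbool A n)))))) :=
    tensorR (Γ := [B]) (headP A) (tensorR (Γ := [B]) (headP A) (tensorR (Γ := [B]) (headP A)
      (tensorR (Γ := [B]) (tailP A) (tensorR (Γ := [N]) (booltypeP A n) (booltypeP A n)))))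
  -- the exchange from `T, τ, σ₁, q₁, σ₂, q₂` to `σ₁, σ₂, τ, T, q₁, q₂`
  have second : Prf [boolF A, boolF A, boolF A, bint A, nbool A n, nbool A n]
      (tensor (bint A) (tensor (boolF A) (tensor (boolF A) (boolF A)))) :=
    exch [boolF A, boolF A] [bint A] (A := boolF A) (Δ := [nbool A n, nbool A n])
      (exch [boolF A] [bint A, boolF A] (A := boolF A) (Δ := [nbool A n, nbool A n])
        (exch [boolF A, bint A, boolF A] [nbool A n] (A := boolF A) (Δ := [nbool A n])
          (exch [] [bint A, boolF A] (A := boolF A) (Δ := [nbool A n, boolF A, nbool A n])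
            (middleP δ A))))
  cut [] (Δ := []) (cut [] (Γ := [B, B, B, B, N, N]) (Δ := []) first (tensorL₆ second))
    (tensorL₄ (recomb₁ A))

/-- The proof `state` of `bint, nbool ⊢ nbool`. -/
def stateP : Prf [bint (cube A), nbool (cube A) n] (nbool A n) :=
  cut [] (Γ := [bint (cube A), nbool (cube A) n]) (Δ := [])
    (tensorR (Γ := [bint (cube A)]) (headP A) (booltypeP A n))
    (tensorL [] (Δ := []) (trans₁ δ A))

/-- The type of Turing configurations. -/
abbrev Tur (A : Formula At) (n : ℕ) : Formula At :=
  tensor (bang (bint A)) (tensor (bang (bint A)) (bang (nbool A n)))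

/-- The proof `step` of `Tur_{A³} ⊢ Tur_A`. -/
def stepP : Prf [Tur (cube A) n] (Tur A n) :=
  let B := bint (cube A)
  let N := nbool (cube A) n
  let S := bang B
  let Q := bang N
  have der₆ {C : Formula At} (π : Prf [B, B, B, B, N, N] C) : Prf [S, S, S, S, Q, Q] C :=
    der [] (Δ := [S, S, S, Q, Q]) (der [B] (Δ := [S, S, Q, Q]) (der [B, B] (Δ := [S, Q, Q])
      (der [B, B, B] (Δ := [Q, Q]) (der [B, B, B, B] (Δ := [Q])
        (der [B, B, B, B, N] (Δ := []) π)))))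
  have l : Prf [S, S, S, S, Q, Q] (bang (bint A)) := prom [B, B, B, B, N, N] (der₆ (leftP δ A))
  have r : Prf [S, S, S, S, Q, Q] (bang (bint A)) := prom [B, B, B, B, N, N] (der₆ (rightP δ A))
  have s : Prf [S, Q] (bang (nbool A n)) := prom [B, N] (der [] (Δ := [Q]) (der [B] (Δ := []) (stateP δ A)))
  have all : Prf [S, S, S, S, Q, Q, S, S, S, S, Q, Q, S, Q] (Tur A n) :=
    tensorR (Γ := [S, S, S, S, Q, Q]) (Δ := [S, S, S, S, Q, Q, S, Q]) l
      (tensorR (Γ := [S, S, S, S, Q, Q]) (Δ := [S, Q]) r s)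
  -- contract the copies of the three arguments that belong to the same component
  have c₁ : Prf [S, S, Q, S, S, S, S, Q, Q, S, Q] (Tur A n) :=
    ctr [S, S] (Δ := [S, S, S, S, Q, Q, S, Q]) (ctr [] (Δ := [S, Q, Q, S, S, S, S, Q, Q, S, Q])
      (ctr [] (Δ := [S, S, Q, Q, S, S, S, S, Q, Q, S, Q]) all))
  have c₂ : Prf [S, S, Q, S, S, Q, S, Q] (Tur A n) :=
    ctr [S, S, Q, S, S] (Δ := [S, Q]) (ctr [S, S, Q, S] (Δ := [Q, Q, S, Q])
      (ctr [S, S, Q] (Δ := [S, S, Q, Q, S, Q]) c₁))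
  -- contract the copies that belong to different components
  have c₃ : Prf [S, S, Q, S, Q] (Tur A n) :=
    ctr [S, S] (Δ := [S, Q]) (ctr [S] (Δ := [Q, Q, S, Q])
      (exch [S, S] [Q] (A := S) (Δ := [Q, S, Q])
        (ctr [] (Δ := [S, Q, S, Q, S, Q]) (exch [S] [S, Q] (A := S) (Δ := [S, Q, S, Q]) c₂))))
  have c₄ : Prf [S, S, Q] (Tur A n) :=
    ctr [S, S] (Δ := []) (ctr [] (Δ := [S, Q, Q]) (exch [S] [S, Q] (A := S) (Δ := [Q]) c₃))
  tensorL [] (Δ := []) (tensorL [S] (Δ := []) c₄)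

end Encodings

end Sweedler

end

open Sweedler

/-! The denotations of `leftP`, `rightP` and `stateP` are linear in each copy of each input. The sum
formulas therefore follow from the action of `headP`, `tailP`, `booltypeP`, `transP` and `recombP`
on denotations of words and booleans. Different copies of `α` are expanded independently: one feeds
the new symbol, another the direction, and for `leftP` a third feeds the tail, so the coefficients
multiply. The direction becomes a combination `w₀ ⟦0⟧ + w₁ ⟦1⟧` (`trans₂_sum`). In the branch that
appends nothing, the summand does not depend on the indices of the unused symbols and the sums
factor (`sum_mul_smul_eq`); this is why the two terms of the answer look different.

The substance lies in the pieces. A binary integer is a function of two arbitrary elements of the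
coalgebra `!E`, which is not in general spanned by vacuum vectors, so equalities of binary integers
cannot be tested on vacua alone. Words are evaluated on arbitrary `x`, `y` through Sweedler
representations: the empty word gives counits, and each digit splits its argument by the
comultiplication, applies the first factor and leaves the second to the rest of the word.
Concatenation then amounts to the counit law and coassociativity (`bintApp_append`), and the tail
works because a promotion is a morphism of coalgebras (`prj_bintApp_tailHom`). The head evaluates
its argument only on promotions of closed proofs, which are vacua, so an elementary induction
suffices (`prj_bintApp_headStep`).

For the step function, vacuum vectors are group-like: contraction duplicates them
(`denP_contractP`), dereliction returns their base point, and promotion sends a tensor of them to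
the vacuum at the value (`denP_prom_der₆`, `denP_prom_der₂`). The fourth equation thus reduces to
the first three. -/

noncomputable section

namespace Sweedler

open Formula

/-! ### Group-like elements of the cofree coalgebra. -/

namespace Cofree

variable {k : Type u} [Field k] {V D : Type u} [AddCommGroup V] [Module k V]
  [AddCommGroup D] [Module k D] [Coalgebra k D]

theorem word_of_isGroupLikeElem (f : D →ₗ[k] V) {g : D} (hg : IsGroupLikeElem k g)
    (w : List (V →ₗ[k] k)) : word f w g = (w.map fun l => l (f g)).prod := by
  induction w with
  | nil => rw [word_nil, hg.counit_eq_one]; rfl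
  | cons l w ih =>
    rw [← List.singleton_append, word_append, hg.comul_eq_tmul_self, TensorProduct.map_tmul,
      LinearMap.mul'_apply, word_singleton, ih]
    rfl

variable [Coalgebra.IsCocomm k D]

/-- Elements of `!V` are separated by words of functionals, and on a group-like element a word is a
product of values that depends only on `f g`. The vacuum is itself such a lift, of the group-like
element `1` of `k`. -/
theorem lift_of_isGroupLikeElem (f : D →ₗ[k] V) {g : D} (hg : IsGroupLikeElem k g) :
    lift f g = vac (k := k) (f g) := by
  refine ext_ev fun w => ?_
  change word f w g = word (LinearMap.toSpanSingleton k V (f g)) w (1 : k)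
  rw [word_of_isGroupLikeElem f hg,
    word_of_isGroupLikeElem _ (isGroupLikeElem_self.2 rfl : IsGroupLikeElem k (1 : k))]
  simp

theorem d_lift_apply (f : D →ₗ[k] V) (x : D) : d (lift f x) = f x := congr($(d_lift f) x)

theorem isGroupLikeElem_vac (P : V) : IsGroupLikeElem k (vac (k := k) P) :=
  IsGroupLikeElem.map (R := k) (lift (LinearMap.toSpanSingleton k V P))
    (isGroupLikeElem_self.2 rfl : IsGroupLikeElem k (1 : k))

theorem d_vac (P : V) : d (vac (k := k) P) = P := by
  rw [vac, d_lift_apply]; simp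

end Cofree

theorem isGroupLikeElem_tmul {k : Type u} [Field k] {C D : Type u} [AddCommGroup C] [Module k C]
    [Coalgebra k C] [AddCommGroup D] [Module k D] [Coalgebra k D] {x : C} {y : D}
    (hx : IsGroupLikeElem k x) (hy : IsGroupLikeElem k y) : IsGroupLikeElem k (x ⊗ₜ[k] y) where
  counit_eq_one := by simp [hx.counit_eq_one, hy.counit_eq_one]
  comul_eq_tmul_self := by
    simp [hx.comul_eq_tmul_self, hy.comul_eq_tmul_self]

/-! ### Sweedler representations of comultiplications. -/

section Repr

variable {k : Type u} [Field k] {C D : Type u} [AddCommGroup C] [Module k C] [Coalgebra k C]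
  [AddCommGroup D] [Module k D] [Coalgebra k D]

/-- The Sweedler representation of a group-like element. -/
def groupLikeRepr {g : C} (hg : IsGroupLikeElem k g) : Coalgebra.Repr k g Unit where
  index := {()}
  left _ := g
  right _ := g
  eq := by rw [Finset.sum_singleton, hg.comul_eq_tmul_self]

/-- The image of a Sweedler representation under a morphism of coalgebras. -/
def mapRepr (F : C →ₗc[k] D) {x : C} {ι : Type u} (R : Coalgebra.Repr k x ι) :
    Coalgebra.Repr k (F x) ι where
  index := R.index
  left i := F (R.left i)
  right i := F (R.right i)
  eq := by
    rw [← CoalgHomClass.map_comp_comul_apply F x, ← R.eq, map_sum]; rfl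

end Repr

/-! ### Denotations of the logical rules on pure tensors. -/

section Rules

variable {k : Type u} [Field k] {At : Type v} (I : At → ModuleCat.{u} k)

/-- The axiom sends `x ⊗ 1` to `1 • x`, which equals `x` by a module axiom but not by computation.
Cut, exchange, dereliction and the rules for `⊸` and `⊗` do compute on concrete pure tensors; hence
the recurring pattern below of inserting axioms with this lemma and closing by `rfl`. -/
theorem denP_ax (A : Formula At) (x : den I A) : denP I (.ax A) (cons I x (nil I)) = x :=
  one_smul k x

/-- The projections of the denotation of `Aⁿ⁺¹`. -/
def prj {A : Formula At} : (n : ℕ) → Fin (n + 1) → (den I (pow A n) →ₗ[k] den I A)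
  | 0, _ => LinearMap.id
  | n + 1, i => Fin.cases (LinearMap.fst k (den I A) (den I (pow A n)))
      (fun j => prj n j ∘ₗ LinearMap.snd k (den I A) (den I (pow A n))) i

/-- The tuples of elements of the denotation of `A`. -/
def tup {A : Formula At} : (n : ℕ) → (Fin (n + 1) → den I A) → den I (pow A n)
  | 0, f => f 0
  | n + 1, f => (show den I A × den I (pow A n) from (f 0, tup n fun i => f i.succ))

theorem prj_tup {A : Formula At} (n : ℕ) (f : Fin (n + 1) → den I A) (i : Fin (n + 1)) :
    prj I n i (tup I n f) = f i := by
  induction n with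
  | zero => obtain rfl := Fin.fin_one_eq_zero i; rfl
  | succ n ih =>
    induction i using Fin.cases with
    | zero => rfl
    | succ j => exact ih (fun i => f i.succ) j

theorem denP_projL {A C : Formula At} {Γ : List (Formula At)} (π : Prf (A :: Γ) C) (n : ℕ)
    (i : Fin (n + 1)) (w : den I (pow A n)) (z : ctx I Γ) :
    denP I (projL π n i) (cons I w z) = denP I π (cons I (prj I n i w) z) := by
  induction n with
  | zero => rfl
  | succ n ih =>
    induction i using Fin.cases with
    | zero => rfl
    | succ j => exact ih j (show den I A × den I (pow A n) from w).2

theorem denP_tupleR {A : Formula At} {Γ : List (Formula At)} (n : ℕ)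
    (f : Fin (n + 1) → Prf Γ A) (z : ctx I Γ) :
    denP I (tupleR n f) z = tup I n fun i => denP I (f i) z := by
  induction n with
  | zero => rfl
  | succ n ih => exact Prod.ext rfl (ih fun i => f i.succ)

theorem denP_projL_ax {A : Formula At} (n : ℕ) (i : Fin (n + 1)) (w : den I (pow A n)) :
    denP I (projL (.ax A) n i) (cons I w (nil I)) = prj I n i w := by
  rw [denP_projL, denP_ax]

theorem elt_nboolP (A : Formula At) (n : ℕ) (i : Fin (n + 1)) :
    elt I (nboolP A n i) = prj I n i :=
  LinearMap.ext fun w => denP_projL_ax I n i w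

/-- The elements of the denotation of a context, factor by factor. -/
def Env : List (Formula At) → Type u
  | [] => PUnit
  | A :: Γ => den I A × Env Γ

/-- Put the pure tensor of the elements of `e` to the left of `z`. -/
def app {Δ : List (Formula At)} : (Γ : List (Formula At)) → Env I Γ → ctx I Δ → ctx I (Γ ++ Δ)
  | [], _, z => z
  | _ :: Γ, e, z => cons I e.1 (app Γ e.2 z)

theorem under_app {Γ Δ : List (Formula At)} (f : ctx I Γ →ₗ[k] ctx I Δ) (Υ : List (Formula At))
    (e : Env I Υ) (z : ctx I Γ) : under I f Υ (app I Υ e z) = app I Υ e (f z) := by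
  induction Υ with
  | nil => rfl
  | cons A Υ ih => exact congrArg (cons I e.1) (ih e.2)

/-- `app` as a linear map. -/
def appLin {Δ : List (Formula At)} :
    (Γ : List (Formula At)) → Env I Γ → (ctx I Δ →ₗ[k] ctx I (Γ ++ Δ))
  | [], _ => LinearMap.id
  | A :: Γ, e => TensorProduct.mk k (den I A) (ctx I (Γ ++ Δ)) e.1 ∘ₗ appLin Γ e.2

theorem appLin_apply {Δ : List (Formula At)} (Γ : List (Formula At)) (e : Env I Γ) (z : ctx I Δ) :
    appLin I Γ e z = app I Γ e z := by
  induction Γ with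
  | nil => rfl
  | cons A Γ ih => exact congrArg (cons I e.1) (ih e.2)

/-- The coalgebra structure of the denotation of `!A`. -/
instance denCoalgebra (A : Formula At) : Coalgebra k (den I (bang A)) :=
  (inferInstance : Coalgebra k (Cofree k (den I A)))

theorem isGroupLikeElem_vacuum {A : Formula At} (x : den I A) :
    IsGroupLikeElem k (vacuum I x) :=
  Cofree.isGroupLikeElem_vac x

/-- The linear map that applies the comultiplication to the first factor of a context. -/
def ctrMap (A : Formula At) (Δ : List (Formula At)) (z : ctx I Δ) :
    den I (bang A) ⊗[k] den I (bang A) →ₗ[k] ctx I (bang A :: bang A :: Δ) :=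
  (TensorProduct.assoc k (den I (bang A)) (den I (bang A)) (ctx I Δ)).toLinearMap ∘ₗ
    (TensorProduct.mk k _ (ctx I Δ)).flip z

/-- The value depends linearly on the comultiplication of `x`, so any representation may be used: a
one-term one for a group-like element, the image of one under a coalgebra morphism, or an arbitrary
one when coassociativity is to be applied. -/
theorem denP_ctr {A C : Formula At} {Δ : List (Formula At)} (Υ : List (Formula At))
    (π : Prf (Υ ++ bang A :: bang A :: Δ) C) (e : Env I Υ) (x : den I (bang A)) (z : ctx I Δ)
    {ι : Type*} (R : Coalgebra.Repr k x ι) :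
    denP I (.ctr Υ π) (app I Υ e (cons I x z)) =
      ∑ i ∈ R.index, denP I π (app I Υ e (cons I (R.left i) (cons I (R.right i) z))) := by
  have h : denP I (.ctr Υ π) (app I Υ e (cons I x z)) =
      (denP I π ∘ₗ appLin I Υ e ∘ₗ ctrMap I A Δ z) (Coalgebra.comul (R := k) x) :=
    (congrArg (denP I π) (under_app I _ Υ e _)).trans
      (congrArg (denP I π) (appLin_apply I Υ e _).symm)
  rw [h, ← R.eq, map_sum]
  exact Finset.sum_congr rfl fun i _ => congrArg (denP I π) (appLin_apply I Υ e _)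

theorem denP_ctr_vacuum {A C : Formula At} {Δ : List (Formula At)} (Υ : List (Formula At))
    (π : Prf (Υ ++ bang A :: bang A :: Δ) C) (e : Env I Υ) (x : den I A) (z : ctx I Δ) :
    denP I (.ctr Υ π) (app I Υ e (cons I (vacuum I x) z)) =
      denP I π (app I Υ e (cons I (vacuum I x) (cons I (vacuum I x) z))) := by
  rw [denP_ctr I Υ π e _ z (groupLikeRepr (isGroupLikeElem_vacuum I x))]
  exact Finset.sum_singleton _ _

theorem denP_weak {A C : Formula At} {Δ : List (Formula At)} (Υ : List (Formula At))
    (π : Prf (Υ ++ Δ) C) (e : Env I Υ) (x : den I (bang A)) (z : ctx I Δ) :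
    denP I (.weak Υ π) (app I Υ e (cons I x z)) =
      Coalgebra.counit (R := k) x • denP I π (app I Υ e z) := by
  rw [← appLin_apply I Υ e z, ← map_smul, ← map_smul, appLin_apply]
  exact congrArg (denP I π) (under_app I _ Υ e _)

theorem isGroupLikeElem_nil :
    IsGroupLikeElem k (A := ctx I (List.map bang ([] : List (Formula At)))) (nil I) :=
  isGroupLikeElem_self (R := k).2 rfl

theorem isGroupLikeElem_cons {A : Formula At} {Γ : List (Formula At)} (x : den I A)
    {z : ctx I (Γ.map bang)} (hz : IsGroupLikeElem k (A := ctx I (Γ.map bang)) z) :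
    IsGroupLikeElem k (A := ctx I (List.map bang (A :: Γ))) (cons I (vacuum I x) z) :=
  isGroupLikeElem_tmul (Cofree.isGroupLikeElem_vac x) hz

/-- Promotion is the lift to the cofree coalgebra, which takes group-like elements to vacua. Tensors
of vacuum vectors qualify, including the empty tensor used for closed proofs. -/
theorem denP_prom {A : Formula At} (Γ : List (Formula At)) (π : Prf (Γ.map bang) A)
    {z : ctx I (Γ.map bang)} (hz : IsGroupLikeElem k (A := ctx I (Γ.map bang)) z) :
    denP I (.prom Γ π) z = vacuum I (denP I π z) :=
  Cofree.lift_of_isGroupLikeElem _ hz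

end Rules

/-! ### Binary integers evaluated on arbitrary elements of `!E`. -/

section BinaryIntegers

variable {k : Type u} [Field k] {At : Type v} (I : At → ModuleCat.{u} k) {A : Formula At}

/-- The elements of the denotation of `A ⊸ B` as linear maps. -/
def ap {A B : Formula At} : den I (lolli A B) →ₗ[k] den I A →ₗ[k] den I B := LinearMap.id

/-- The value of an element of the denotation of `bint`. -/
def bintApp (X : den I (bint A)) (x y : den I (bang (endo A))) (v : den I A) : den I A :=
  ap I (ap I (ap I X x) y) v

variable {I} in
theorem bint_ext {X Y : den I (bint A)}
    (h : ∀ x y v, bintApp I X x y v = bintApp I Y x y v) : X = Y :=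
  LinearMap.ext fun x => LinearMap.ext fun y => LinearMap.ext fun v => h x y v

/-- The value of the universal map on an element of `!(A ⊸ A)`. -/
def derApp (x : den I (bang (endo A))) (v : den I A) : den I A :=
  ap I (Cofree.d (k := k) (V := den I (endo A)) x) v

theorem derApp_vacuum (f : den I (endo A)) (v : den I A) :
    derApp I (vacuum I f) v = ap I f v :=
  congrArg (fun g => ap I g v) (Cofree.d_vac f)

theorem bintApp_bintP (S : List (Fin 2)) (x y : den I (bang (endo A))) (v : den I A) :
    bintApp I (elt I (bintP A S)) x y v =
      denP I (bintAux A S) (cons I v (cons I x (cons I y (nil I)))) := rfl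

theorem bintApp_bintP_nil (x y : den I (bang (endo A))) (v : den I A) :
    bintApp I (elt I (bintP A [])) x y v =
      Coalgebra.counit (R := k) x • Coalgebra.counit (R := k) y • v := by
  rw [bintApp_bintP, bintAux]
  refine (denP_weak I [A] _ (v, ⟨⟩) x (cons I y (nil I))).trans ?_
  refine congrArg _ ((denP_weak I [A] _ (v, ⟨⟩) y (nil I)).trans ?_)
  exact congrArg _ (denP_ax I A v)

/-- The contraction splits `x`: the first factor is derelicted and applied to `v` at once, the
second is kept for the remaining word, and `y` passes through. -/
theorem bintApp_bintP_cons_zero (S : List (Fin 2)) (x y : den I (bang (endo A))) (v : den I A)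
    {ι : Type*} (R : Coalgebra.Repr k x ι) :
    bintApp I (elt I (bintP A (0 :: S))) x y v =
      ∑ i ∈ R.index, bintApp I (elt I (bintP A S)) (R.right i) y (derApp I (R.left i) v) := by
  rw [bintApp_bintP, bintAux, if_pos rfl]
  refine (denP_ctr I [A] _ (v, ⟨⟩) x (cons I y (nil I)) R).trans
    (Finset.sum_congr rfl fun i _ => ?_)
  rw [bintApp_bintP]
  -- The left rule for `⊸` receives `v` through an axiom, so that axiom is put back before comparing
  -- by computation.
  conv_rhs => rw [← denP_ax I A v]
  rfl

theorem bintApp_bintP_cons_one (S : List (Fin 2)) (x y : den I (bang (endo A))) (v : den I A)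
    {ι : Type*} (R : Coalgebra.Repr k y ι) :
    bintApp I (elt I (bintP A (1 :: S))) x y v =
      ∑ i ∈ R.index, bintApp I (elt I (bintP A S)) x (R.right i) (derApp I (R.left i) v) := by
  rw [bintApp_bintP, bintAux, if_neg one_ne_zero]
  refine (denP_ctr I [A, bang (endo A)] _ (v, x, ⟨⟩) y (nil I) R).trans
    (Finset.sum_congr rfl fun i _ => ?_)
  rw [bintApp_bintP]
  conv_rhs => rw [← denP_ax I A v]
  rfl

end BinaryIntegers

/-! ### Concatenation of words and coassociativity. -/

section Concatenation

/-- Coassociativity, for compositions of linear maps that depend linearly on an element of a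
coalgebra. -/
theorem sum_sum_comp_eq {k : Type u} [Field k] {C M N P : Type*} [AddCommGroup C]
    [Module k C] [Coalgebra k C] [AddCommGroup M] [Module k M] [AddCommGroup N] [Module k N]
    [AddCommGroup P] [Module k P] (F : C →ₗ[k] N →ₗ[k] P) (H : C →ₗ[k] M →ₗ[k] N)
    (K : C →ₗ[k] M) {x : C} {ι : Type*} {κ Λ : ι → Type*} (R : Coalgebra.Repr k x ι)
    (R₁ : (i : ι) → Coalgebra.Repr k (R.left i) (κ i))
    (R₂ : (i : ι) → Coalgebra.Repr k (R.right i) (Λ i)) :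
    ∑ i ∈ R.index, ∑ j ∈ (R₁ i).index,
        F (R.right i) (H ((R₁ i).right j) (K ((R₁ i).left j))) =
      ∑ i ∈ R.index, ∑ j ∈ (R₂ i).index,
        F ((R₂ i).right j) (H ((R₂ i).left j) (K (R.left i))) := by
  let U : C ⊗[k] C →ₗ[k] M →ₗ[k] P := TensorProduct.lift
    (LinearMap.mk₂ k (fun b c => F c ∘ₗ H b) (fun _ _ _ => by ext; simp)
      (fun _ _ _ => by ext; simp) (fun _ _ _ => by ext; simp) (fun _ _ _ => by ext; simp))
  -- The map `a ⊗ (b ⊗ c) ↦ F c (H b (K a))`; both sides are its values on the two iterated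
  -- comultiplications of `x`.
  let T : C ⊗[k] (C ⊗[k] C) →ₗ[k] P := TensorProduct.lift
    (LinearMap.mk₂ k (fun a t => U t (K a)) (fun _ _ _ => by simp)
      (fun _ _ _ => by simp) (fun _ _ _ => by simp) (fun _ _ _ => by simp))
  simpa [T, U] using congrArg T (Coalgebra.sum_tmul_tmul_eq R R₁ R₂)

variable {k : Type u} [Field k] {At : Type v} (I : At → ModuleCat.{u} k) {A : Formula At}

/-- The part of `concatP` above the contractions. -/
def concatOpen (A : Formula At) : Prf [bint A, bang (endo A), bang (endo A), bint A,
    bang (endo A), bang (endo A)] (endo A) :=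
  let E := bang (endo A)
  .lolliL [] (Γ := [E]) (Δ := [E, bint A, E, E]) (.ax E)
    (.lolliL [] (Γ := [E]) (Δ := [bint A, E, E]) (.ax E)
      (.lolliL [endo A] (Γ := [E]) (Δ := [E]) (.ax E)
        (.lolliL [endo A] (Γ := [E]) (Δ := []) (.ax E) (.lolliR (compP A)))))

theorem denP_concatOpen (X Y : den I (bint A)) (x y x' y' : den I (bang (endo A)))
    (v : den I A) :
    ap I (denP I (concatOpen A) (cons I X (cons I x (cons I y (cons I Y (cons I x'
      (cons I y' (nil I)))))))) v = bintApp I Y x' y' (bintApp I X x y v) := by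
  have h : bintApp I Y (denP I (.ax _) (cons I x' (nil I))) (denP I (.ax _) (cons I y' (nil I)))
      (denP I (.ax A) (cons I (bintApp I X (denP I (.ax _) (cons I x (nil I)))
        (denP I (.ax _) (cons I y (nil I))) (denP I (.ax _) (cons I v (nil I)))) (nil I))) = bintApp I Y x' y' (bintApp I X x y v) := by
    simp only [denP_ax]
  rw [← h, ← denP_ax I A (bintApp I Y _ _ _)]
  rfl

set_option maxRecDepth 4000 in
theorem bintApp_concatP (X Y : den I (bint A)) (x y : den I (bang (endo A))) (v : den I A)
    {ι κ : Type u} (R : Coalgebra.Repr k x ι) (R' : Coalgebra.Repr k y κ) :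
    bintApp I (denP I (concatP A) (cons I X (cons I Y (nil I)))) x y v =
      ∑ j ∈ R'.index, ∑ i ∈ R.index, bintApp I Y (R.right i) (R'.right j)
        (bintApp I X (R.left i) (R'.left j) v) := by
  let c (f g : den I (endo A)) : den I (endo A) := (ap I g ∘ₗ ap I f :)
  have h : ap I (ap I (denP I (concatP A) (cons I X (cons I Y (nil I)))) x) y =
      ∑ j ∈ R'.index, ∑ i ∈ R.index, c (ap I (ap I X (R.left i)) (R'.left j))
        (ap I (ap I Y (R.right i)) (R'.right j)) := by
    -- The right rules and outer exchanges vanish by computation. The contraction of `y` is the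
    -- outermost one left, so its sum stands outside that of `x`.
    have h₁ : ap I (ap I (denP I (concatP A) (cons I X (cons I Y (nil I)))) x) y =
        denP I (.ctr [bint A, bang (endo A)] (Δ := [bint A])
          (.exch [bint A, bang (endo A), bang (endo A)] [bint A] (A := bang (endo A)) (Δ := [])
            (.ctr [bint A] (Δ := [bang (endo A), bint A, bang (endo A)])
              (.exch [bint A, bang (endo A)] [bang (endo A), bint A] (A := bang (endo A))
                (Δ := [bang (endo A)]) (concatOpen A)))))
          (cons I X (cons I x (cons I y (cons I Y (nil I))))) := rfl
    rw [h₁]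
    refine (denP_ctr I [bint A, bang (endo A)] _ (X, x, ⟨⟩) y (cons I Y (nil I)) R').trans ?_
    refine Finset.sum_congr rfl fun j _ => ?_
    change denP I (.ctr [bint A] (Δ := [bang (endo A), bint A, bang (endo A)])
      (.exch [bint A, bang (endo A)] [bang (endo A), bint A] (A := bang (endo A))
        (Δ := [bang (endo A)]) (concatOpen A))) (app I [bint A] (X, ⟨⟩) _) = _
    refine (denP_ctr I [bint A] _ (X, ⟨⟩) x
      (cons I (R'.left j) (cons I Y (cons I (R'.right j) (nil I)))) R).trans ?_
    exact Finset.sum_congr rfl fun i _ => LinearMap.ext fun v =>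
      denP_concatOpen I X Y (R.left i) (R'.left j) (R.right i) (R'.right j) v
  rw [bintApp, h, map_sum, LinearMap.sum_apply]
  refine Finset.sum_congr rfl fun j _ => ?_
  rw [map_sum, LinearMap.sum_apply]
  rfl

/-- `derApp` as a linear map. -/
def derLin (v : den I A) : den I (bang (endo A)) →ₗ[k] den I A :=
  (ap I).flip v ∘ₗ Cofree.d (k := k) (V := den I (endo A))

theorem bintApp_sum (X : den I (bint A)) (x y : den I (bang (endo A))) {ι : Type*}
    (s : Finset ι) (f : ι → den I A) :
    bintApp I X x y (∑ i ∈ s, f i) = ∑ i ∈ s, bintApp I X x y (f i) :=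
  map_sum (ap I (ap I (ap I X x) y)) f s

/-- Coassociativity for the first argument: one factor is spent on a leading digit, the next on `X`,
the last on `Y`, and it does not matter which factor is split again. -/
theorem sum_sum_bintApp_left (X Y : den I (bint A)) (x y y' : den I (bang (endo A)))
    (v : den I A) {ι : Type*} {κ Λ : ι → Type*} (R : Coalgebra.Repr k x ι)
    (R₁ : (i : ι) → Coalgebra.Repr k (R.left i) (κ i))
    (R₂ : (i : ι) → Coalgebra.Repr k (R.right i) (Λ i)) :
    ∑ i ∈ R.index, ∑ j ∈ (R₂ i).index, bintApp I Y ((R₂ i).right j) y'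
        (bintApp I X ((R₂ i).left j) y (derApp I (R.left i) v)) =
      ∑ i ∈ R.index, ∑ j ∈ (R₁ i).index, bintApp I Y (R.right i) y'
        (bintApp I X ((R₁ i).right j) y (derApp I ((R₁ i).left j) v)) := by
  let F (Z : den I (bint A)) (z : den I (bang (endo A))) :
      den I (bang (endo A)) →ₗ[k] den I A →ₗ[k] den I A := ap I ∘ₗ (ap I).flip z ∘ₗ ap I Z
  have hF (Z z w u) : F Z z w u = bintApp I Z w z u := rfl
  have hD (w) : derApp I w v = derLin I v w := rfl
  simp only [← hF, hD]
  exact (sum_sum_comp_eq (F Y y') (F X y) (derLin I v) R R₁ R₂).symm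

theorem sum_sum_bintApp_right (X Y : den I (bint A)) (x x' y : den I (bang (endo A)))
    (v : den I A) {ι : Type*} {κ Λ : ι → Type*} (R : Coalgebra.Repr k y ι)
    (R₁ : (i : ι) → Coalgebra.Repr k (R.left i) (κ i))
    (R₂ : (i : ι) → Coalgebra.Repr k (R.right i) (Λ i)) :
    ∑ i ∈ R.index, ∑ j ∈ (R₂ i).index, bintApp I Y x' ((R₂ i).right j)
        (bintApp I X x ((R₂ i).left j) (derApp I (R.left i) v)) =
      ∑ i ∈ R.index, ∑ j ∈ (R₁ i).index, bintApp I Y x' (R.right i)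
        (bintApp I X x ((R₁ i).right j) (derApp I ((R₁ i).left j) v)) :=
  (sum_sum_comp_eq (ap I (ap I Y x')) (ap I (ap I X x)) (derLin I v) R R₁ R₂).symm

open Coalgebra in
-- Both arguments are shared out between the two words. Induction on the first word: the counit law
-- handles the empty word, coassociativity each further digit.
theorem bintApp_append (S W : List (Fin 2)) (x y : den I (bang (endo A))) (v : den I A)
    {ι κ : Type u} (R : Coalgebra.Repr k x ι) (R' : Coalgebra.Repr k y κ) :
    bintApp I (elt I (bintP A (S ++ W))) x y v =
      ∑ j ∈ R'.index, ∑ i ∈ R.index, bintApp I (elt I (bintP A W)) (R.right i) (R'.right j)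
        (bintApp I (elt I (bintP A S)) (R.left i) (R'.left j) v) := by
  induction S generalizing x y v ι κ with
  | nil =>
    rw [List.nil_append]
    -- The empty word on the right produces counits of the left factors; expanding `x` and `y` by
    -- the counit law gives the left side the same form.
    conv_lhs => rw [← Coalgebra.sum_counit_smul R, ← Coalgebra.sum_counit_smul R']
    simp only [bintApp_bintP_nil]
    simp only [bintApp, map_sum, map_smul, LinearMap.sum_apply, LinearMap.smul_apply,
      Finset.smul_sum]
    refine Finset.sum_congr rfl fun j _ => Finset.sum_congr rfl fun i _ => ?_
    rw [smul_comm]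
  | cons σ S ih =>
    obtain rfl | rfl : σ = 0 ∨ σ = 1 := by omega
    · rw [List.cons_append, bintApp_bintP_cons_zero I _ x y v R]
      simp only [fun i => ih (R.right i) y (derApp I (R.left i) v) (ℛ k (R.right i)) R',
        fun i j => bintApp_bintP_cons_zero I S (R.left i) (R'.left j) v (ℛ k (R.left i))]
      simp only [bintApp_sum]
      rw [Finset.sum_comm]
      -- On the left the digit is removed first and the second factor of `x` is then shared between
      -- `S` and `W`; on the right the share of the longer word is split afterwards.
      exact Finset.sum_congr rfl fun j _ => sum_sum_bintApp_left I _ _ _ _ _ _ R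
        (fun i => ℛ k (R.left i)) (fun i => ℛ k (R.right i))
    · rw [List.cons_append, bintApp_bintP_cons_one I _ x y v R']
      simp only [fun j => ih x (R'.right j) (derApp I (R'.left j) v) R (ℛ k (R'.right j)),
        fun i j => bintApp_bintP_cons_one I S (R.left i) (R'.left j) v (ℛ k (R'.left j))]
      simp only [bintApp_sum]
      -- For a digit `1` it is `y` that is split twice, so the sum over the representation of `x` is
      -- moved outside on both sides.
      refine ((Finset.sum_congr rfl fun j _ => Finset.sum_comm).trans Finset.sum_comm).trans ?_
      refine Eq.trans ?_ Finset.sum_comm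
      exact Finset.sum_congr rfl fun i _ => sum_sum_bintApp_right I _ _ _ _ _ _ R'
        (fun j => ℛ k (R'.left j)) (fun j => ℛ k (R'.right j))

set_option maxRecDepth 4000 in
open Coalgebra in
theorem denP_appendP (S W : List (Fin 2)) :
    denP I (appendP A W) (cons I (elt I (bintP A S)) (nil I)) = elt I (bintP A (S ++ W)) := by
  have h : denP I (appendP A W) (cons I (elt I (bintP A S)) (nil I)) =
    denP I (concatP A) (cons I (elt I (bintP A S)) (cons I (elt I (bintP A W)) (nil I))) := rfl
  refine h.trans (bint_ext fun x y v => ?_)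
  rw [bintApp_concatP I _ _ x y v (ℛ k x) (ℛ k y), bintApp_append I S W x y v (ℛ k x) (ℛ k y)]

end Concatenation

/-! ### Head, tail, booleans and recombination on basic data. -/

section HeadTail

variable {k : Type u} [Field k] {At : Type v} (I : At → ModuleCat.{u} k) {A : Formula At}

theorem sum_counit_right_smul {C : Type*} [AddCommGroup C] [Module k C] [Coalgebra k C] {x : C}
    {ι : Type*} (R : Coalgebra.Repr k x ι) :
    ∑ i ∈ R.index, Coalgebra.counit (R := k) (R.right i) • R.left i = x := by
  simpa only [map_sum, TensorProduct.rid_tmul, one_smul] using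
    congrArg (TensorProduct.rid k C) (Coalgebra.sum_tmul_counit_eq R)

open Coalgebra in
-- The unused second factor of `x` is killed by a weakening, and the counit law restores `x`; the
-- unused `y` leaves its counit.
theorem bintApp_bintP_zero (x y : den I (bang (endo A))) (v : den I A) :
    bintApp I (elt I (bintP A [0])) x y v = Coalgebra.counit (R := k) y • derApp I x v := by
  rw [bintApp_bintP_cons_zero I [] x y v (ℛ k x)]
  have hD (w) : derApp I w v = derLin I v w := rfl
  conv_rhs => rw [← sum_counit_right_smul (ℛ k x), hD, map_sum, Finset.smul_sum]
  refine Finset.sum_congr rfl fun i _ => ?_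
  rw [bintApp_bintP_nil, map_smul, smul_comm, hD]

open Coalgebra in
theorem bintApp_bintP_one (x y : den I (bang (endo A))) (v : den I A) :
    bintApp I (elt I (bintP A [1])) x y v = Coalgebra.counit (R := k) x • derApp I y v := by
  rw [bintApp_bintP_cons_one I [] x y v (ℛ k y)]
  have hD (w) : derApp I w v = derLin I v w := rfl
  conv_rhs => rw [← sum_counit_right_smul (ℛ k y), hD, map_sum, Finset.smul_sum]
  refine Finset.sum_congr rfl fun i _ => ?_
  rw [bintApp_bintP_nil, map_smul, hD]

theorem bintApp_bintP_cons_vacuum (S : List (Fin 2)) (σ : Fin 2) (f : Fin 2 → den I (endo A))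
    (v : den I A) :
    bintApp I (elt I (bintP A (σ :: S))) (vacuum I (f 0)) (vacuum I (f 1)) v =
      bintApp I (elt I (bintP A S)) (vacuum I (f 0)) (vacuum I (f 1)) (ap I (f σ) v) := by
  obtain rfl | rfl : σ = 0 ∨ σ = 1 := by omega
  · rw [bintApp_bintP_cons_zero I S _ _ v (groupLikeRepr (isGroupLikeElem_vacuum I (f 0))),
      ← derApp_vacuum]
    exact Finset.sum_singleton _ _
  · rw [bintApp_bintP_cons_one I S _ _ v (groupLikeRepr (isGroupLikeElem_vacuum I (f 1))),
      ← derApp_vacuum]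
    exact Finset.sum_singleton _ _

theorem bintApp_bintP_nil_vacuum (f g : den I (endo A)) (v : den I A) :
    bintApp I (elt I (bintP A [])) (vacuum I f) (vacuum I g) v = v := by
  rw [bintApp_bintP_nil, (isGroupLikeElem_vacuum I f).counit_eq_one,
    (isGroupLikeElem_vacuum I g).counit_eq_one, one_smul, one_smul]

theorem ap_denP_headP (X : den I (bint (cube A))) (w : den I (pow A 1)) :
    ap I (denP I (headP A) (cons I X (nil I))) w =
      prj I 2 2 (bintApp I X (vacuum I (elt I (.lolliR (headStep A 0))))
        (vacuum I (elt I (.lolliR (headStep A 1))))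
        (tup I 2 ![prj I 1 0 w, prj I 1 1 w, prj I 1 0 w])) := by
  have h (i : Fin 3) : denP I (.prom [] (.lolliR (headStep A i))) (nil I) =
      vacuum I (elt I (.lolliR (headStep A i))) := denP_prom I [] _ (isGroupLikeElem_nil I)
  have h₁ : denP I (headInit A) (cons I w (nil I)) =
      tup I 2 ![prj I 1 0 w, prj I 1 1 w, prj I 1 0 w] := by
    rw [headInit, denP_tupleR]
    congr 1
    ext i
    fin_cases i
    exacts [denP_projL_ax I 1 0 w, denP_projL_ax I 1 1 w, denP_projL_ax I 1 0 w]
  rw [← h, ← h, ← h₁, ← denP_projL_ax]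
  rfl

theorem ap_elt_headStep (i : Fin 3) (v : den I (cube A)) :
    ap I (elt I (.lolliR (headStep A i))) v =
      tup I 2 ![prj I 2 0 v, prj I 2 1 v, prj I 2 i v] := by
  change denP I (headStep A i) (cons I v (nil I)) = _
  rw [headStep, denP_tupleR]
  congr 1
  ext j
  fin_cases j
  exacts [denP_projL_ax I 2 0 v, denP_projL_ax I 2 1 v, denP_projL_ax I 2 i v]

/-- The steps never change the first two coordinates, and the step of digit `σ` copies coordinate
`σ` into the third. The last digit thus decides the third coordinate, in terms of the initial `v`.
-/
theorem prj_bintApp_headStep (S : List (Fin 2)) (σ : Fin 2) (v : den I (cube A)) :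
    prj I 2 2 (bintApp I (elt I (bintP (cube A) (S ++ [σ])))
      (vacuum I (elt I (.lolliR (headStep A 0)))) (vacuum I (elt I (.lolliR (headStep A 1)))) v) =
      prj I 2 σ.castSucc v := by
  let f (i : Fin 2) : den I (endo (cube A)) := elt I (.lolliR (headStep A i.castSucc))
  have hf (i : Fin 2) : ap I (f i) v =
      tup I 2 ![prj I 2 0 v, prj I 2 1 v, prj I 2 i.castSucc v] := ap_elt_headStep I _ v
  change prj I 2 2 (bintApp I _ (vacuum I (f 0)) (vacuum I (f 1)) v) = _
  induction S generalizing v with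
  | nil =>
    rw [List.nil_append, bintApp_bintP_cons_vacuum, bintApp_bintP_nil_vacuum]
    rw [ap_elt_headStep, prj_tup]
    rfl
  | cons s S ih =>
    rw [List.cons_append, bintApp_bintP_cons_vacuum, ih _ (fun i => ap_elt_headStep I _ _),
      ap_elt_headStep, prj_tup]
    fin_cases σ <;> rfl

theorem denP_headP (S : List (Fin 2)) (σ : Fin 2) :
    denP I (headP A) (cons I (elt I (bintP (cube A) (S ++ [σ]))) (nil I)) =
      elt I (nboolP A 1 σ) := by
  refine LinearMap.ext fun w => (ap_denP_headP I _ w).trans ?_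
  rw [prj_bintApp_headStep, prj_tup, elt_nboolP]
  fin_cases σ <;> rfl

/-- The morphism of coalgebras `!V → !W` lifting a linear map `!V ⊗ k → W`. -/
def Cofree.liftTmul {V W : Type u} [AddCommGroup V] [Module k V] [AddCommGroup W] [Module k W]
    (f : Cofree k V ⊗[k] k →ₗ[k] W) : Cofree k V →ₗc[k] Cofree k W :=
  (Cofree.lift f).comp
    (Coalgebra.TensorProduct.rid k k (Cofree k V)).symm.toCoalgHom

theorem Cofree.d_liftTmul {V W : Type u} [AddCommGroup V] [Module k V] [AddCommGroup W]
    [Module k W] (f : Cofree k V ⊗[k] k →ₗ[k] W) (x : Cofree k V) :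
    Cofree.d (Cofree.liftTmul f x) = f (x ⊗ₜ 1) :=
  Cofree.d_lift_apply f (x ⊗ₜ 1)

/-- The promotion of `tailStep` as a morphism of coalgebras. -/
def tailHom (A : Formula At) :
    den I (bang (endo A)) →ₗc[k] den I (bang (endo (cube A))) :=
  Cofree.liftTmul (V := den I (endo A)) (W := den I (endo (cube A))) (denP I (tailStep A))

theorem tailHom_apply (x : den I (bang (endo A))) :
    denP I (.prom [endo A] (tailStep A)) (cons I x (nil I)) = tailHom I A x := rfl

/-- For general `x` the two coordinates that ignore the endomorphism come from weakenings and carry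
a counit, invisible on vacua. -/
theorem derApp_tailHom (x : den I (bang (endo A))) (v : den I (cube A)) :
    derApp I (tailHom I A x) v = tup I 2 ![Coalgebra.counit (R := k) x • prj I 2 2 v,
      Coalgebra.counit (R := k) x • prj I 2 2 v, derApp I x (prj I 2 2 v)] := by
  have h : derApp I (tailHom I A x) v =
      ap I (denP I (tailStep A) (cons I x (nil I))) v :=
    congrArg (fun f => ap I f v) (Cofree.d_liftTmul (V := den I (endo A))
      (W := den I (endo (cube A))) (denP I (tailStep A)) x)
  refine h.trans ?_
  change denP I (tupleR 2 ![.weak [cube A] (Δ := []) (projL (.ax A) 2 2),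
    .weak [cube A] (Δ := []) (projL (.ax A) 2 2),
    .der [cube A] (Δ := []) (projL (evalP A) 2 2)]) (cons I v (cons I x (nil I))) = _
  rw [denP_tupleR]
  congr 1
  ext i
  have hp : denP I (.weak [cube A] (Δ := []) (projL (.ax A) 2 2)) (cons I v (cons I x (nil I))) =
      Coalgebra.counit (R := k) x • prj I 2 2 v := by
    rw [← denP_projL_ax I 2 2 v]
    exact denP_weak I [cube A] _ (v, ⟨⟩) x (nil I)
  have hq : denP I (.der [cube A] (Δ := []) (projL (evalP A) 2 2))
      (cons I v (cons I x (nil I))) = derApp I x (prj I 2 2 v) := by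
    refine (denP_projL I (evalP A) 2 2 v
      (cons I (Cofree.d (k := k) (V := den I (endo A)) x) (nil I))).trans ?_
    conv_rhs => rw [← denP_ax I A (derApp I x _), ← denP_ax I A (prj I 2 2 v)]
    rfl
  fin_cases i
  exacts [hp, hp, hq]

open Coalgebra in
-- The third coordinate runs the word, while the first stores the third coordinate from before the
-- current step, so it ends one digit behind. The initial first two coordinates play no role.
theorem prj_bintApp_tailHom (S : List (Fin 2)) (σ : Fin 2) (x y : den I (bang (endo A)))
    (v : den I (cube A)) :
    prj I 2 0 (bintApp I (elt I (bintP (cube A) (S ++ [σ]))) (tailHom I A x) (tailHom I A y) v) =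
      bintApp I (elt I (bintP A S)) x y (prj I 2 2 v) := by
  induction S generalizing x y v with
  | nil =>
    -- For a one-letter word both arguments contribute only counits, which the coalgebra morphism
    -- preserves; they match the two weakenings of the empty word.
    have h (z z' : den I (bang (endo A))) :
        prj I 2 0 (Coalgebra.counit (R := k) (tailHom I A z') • derApp I (tailHom I A z) v) =
          Coalgebra.counit (R := k) z' • Coalgebra.counit (R := k) z • prj I 2 2 v := by
      rw [map_smul, derApp_tailHom, prj_tup, CoalgHomClass.counit_comp_apply]
      rfl
    rw [List.nil_append, bintApp_bintP_nil]
    obtain rfl | rfl : σ = 0 ∨ σ = 1 := by omega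
    · rw [bintApp_bintP_zero, h, smul_comm]
    · rw [bintApp_bintP_one, h]
  | cons s S ih =>
    obtain rfl | rfl : s = 0 ∨ s = 1 := by omega
    -- Contracting the image of `x` with the image of a representation of `x` makes the sums on the
    -- two sides correspond term by term.
    · rw [List.cons_append, bintApp_bintP_cons_zero I _ _ _ v (mapRepr (tailHom I A) (ℛ k x)),
        bintApp_bintP_cons_zero I S x y _ (ℛ k x), map_sum]
      refine Finset.sum_congr rfl fun i _ => (ih _ _ _).trans ?_
      rw [mapRepr, derApp_tailHom, prj_tup]
      rfl
    · rw [List.cons_append, bintApp_bintP_cons_one I _ _ _ v (mapRepr (tailHom I A) (ℛ k y)),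
        bintApp_bintP_cons_one I S x y _ (ℛ k y), map_sum]
      refine Finset.sum_congr rfl fun i _ => (ih _ _ _).trans ?_
      rw [mapRepr, derApp_tailHom, prj_tup]
      rfl

theorem bintApp_denP_tailP (X : den I (bint (cube A))) (x y : den I (bang (endo A)))
    (v : den I A) :
    bintApp I (denP I (tailP A) (cons I X (nil I))) x y v =
      prj I 2 0 (bintApp I X (tailHom I A x) (tailHom I A y) (tup I 2 fun _ => v)) := by
  have h : denP I (tupleR 2 fun _ => .ax A) (cons I v (nil I)) = tup I 2 fun _ => v := by
    rw [denP_tupleR]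
    simp only [denP_ax]
  rw [← h, ← tailHom_apply, ← tailHom_apply, ← denP_projL_ax]
  rfl

theorem denP_tailP (S : List (Fin 2)) (σ : Fin 2) :
    denP I (tailP A) (cons I (elt I (bintP (cube A) (S ++ [σ]))) (nil I)) =
      elt I (bintP A S) :=
  bint_ext fun x y v => by rw [bintApp_denP_tailP, prj_bintApp_tailHom, prj_tup]

theorem denP_booltypeP (n : ℕ) (q : Fin (n + 1)) :
    denP I (booltypeP A n) (cons I (elt I (nboolP (cube A) n q)) (nil I)) =
      elt I (nboolP A n q) := by
  refine LinearMap.ext fun w => ?_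
  have h : denP I (tupleR n fun i => tupleR 2 fun _ => projL (.ax A) n i) (cons I w (nil I)) =
      tup (A := cube A) I n fun i => tup I 2 fun _ => prj I n i w := by
    rw [denP_tupleR]
    congr 1
    ext i
    rw [denP_tupleR]
    simp only [denP_projL_ax]
  have h' : ap I (denP I (booltypeP A n) (cons I (elt I (nboolP (cube A) n q)) (nil I))) w =
      denP I (projL (.ax A) 2 0) (cons I (ap I (elt I (nboolP (cube A) n q))
        (denP I (tupleR n fun i => tupleR 2 fun _ => projL (.ax A) n i) (cons I w (nil I))))
          (nil I)) := rfl
  refine h'.trans ?_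
  rw [h, denP_projL_ax, elt_nboolP, elt_nboolP]
  exact (congrArg (prj I 2 0) (prj_tup (A := cube A) I n _ q)).trans (prj_tup I 2 _ 0)

theorem denP_funP {n m : ℕ} (f : Fin (n + 1) → Fin (m + 1)) (w : den I (pow A m))
    (φ : den I (nbool A n)) :
    denP I (funP A f) (cons I w (cons I φ (nil I))) =
      ap I φ (tup I n fun i => prj I m (f i) w) := by
  have h : denP I (tupleR n fun i => projL (.ax A) m (f i)) (cons I w (nil I)) =
      tup I n fun i => prj I m (f i) w := by
    rw [denP_tupleR]
    simp only [denP_projL_ax]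
  rw [← h, ← denP_ax I A (ap I φ _)]
  rfl

/-- Both booleans are projections: the outer one selects the branch of `σ`, and the inner one
selects entry `q` of the tuple fed to it. -/
theorem denP_transP {n m : ℕ} (f : Fin 2 → Fin (n + 1) → Fin (m + 1)) (σ : Fin 2)
    (q : Fin (n + 1)) :
    denP I (transP A f) (cons I (elt I (nboolP A 1 σ)) (cons I (elt I (nboolP A n q)) (nil I))) =
      elt I (nboolP A m (f σ q)) := by
  refine LinearMap.ext fun w => ?_
  have h (ψ : den I (boolF A)) (φ : den I (nbool A n)) :
      ap I (denP I (transP A f) (cons I ψ (cons I φ (nil I)))) w =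
      ap I ψ (denP I (tupleR 1 fun j => funP A (f j)) (cons I w (cons I φ (nil I)))) :=
    denP_ax I A _
  refine (h _ _).trans ?_
  rw [denP_tupleR, elt_nboolP, elt_nboolP, elt_nboolP]
  refine (prj_tup I 1 _ σ).trans ?_
  refine (denP_funP I _ _ _).trans ?_
  exact prj_tup I n _ q

set_option maxRecDepth 4000 in
theorem denP_appendOpen (W : List (Fin 2)) (X : den I (bint A)) (x y : den I (bang (endo A)))
    (v : den I A) :
    denP I (appendOpen A W) (cons I X (cons I x (cons I y (cons I v (nil I))))) =
      bintApp I (denP I (appendP A W) (cons I X (nil I))) x y v := by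
  conv_rhs => rw [← denP_ax I A (bintApp I _ x y v), ← denP_ax I _ x, ← denP_ax I _ y,
    ← denP_ax I A v]
  rfl

/-- The rule `&R` shares its context, so every branch receives the same `X`, `x`, `y`, `v` without a
contraction; this holds for arbitrary elements in place of the booleans. -/
theorem denP_caseOpen (W : Fin 2 → Fin 2 → List (Fin 2)) (X : den I (bint A))
    (τ σ : den I (boolF A)) (x y : den I (bang (endo A))) (v : den I A) :
    denP I (caseOpen A W) (cons I τ (cons I σ (cons I X (cons I x (cons I y
      (cons I v (nil I))))))) =
      ap I τ (tup I 1 fun t => ap I σ (tup I 1 fun s =>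
        bintApp I (denP I (appendP A (W t s)) (cons I X (nil I))) x y v)) := by
  have h (t : Fin 2) : denP I (.lolliL [] (Γ := [bint A, bang (endo A), bang (endo A), A])
      (Δ := []) (tupleR 1 fun s => appendOpen A (W t s)) (.ax A)) (cons I σ (cons I X (cons I x
        (cons I y (cons I v (nil I)))))) = ap I σ (tup I 1 fun s =>
          bintApp I (denP I (appendP A (W t s)) (cons I X (nil I))) x y v) := by
    simp only [← denP_appendOpen]
    rw [← denP_tupleR, ← denP_ax I A (ap I σ _)]
    rfl
  simp only [← h]
  rw [← denP_tupleR, ← denP_ax I A (ap I τ _)]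
  rfl

/-- The part of `recombP` above the exchanges. -/
def recombOpen (A : Formula At) (W : Fin 2 → Fin 2 → Fin 2 → List (Fin 2)) :
    Prf [boolF A, boolF A, boolF A, bint A, bang (endo A), bang (endo A), A] A :=
  .lolliL [] (Γ := [boolF A, boolF A, bint A, bang (endo A), bang (endo A), A]) (Δ := [])
    (tupleR 1 fun d => caseOpen A (W d)) (.ax A)

theorem denP_recombOpen (W : Fin 2 → Fin 2 → Fin 2 → List (Fin 2)) (X : den I (bint A))
    (τ σ d : den I (boolF A)) (x y : den I (bang (endo A))) (v : den I A) :
    denP I (recombOpen A W) (cons I d (cons I τ (cons I σ (cons I X (cons I x (cons I y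
      (cons I v (nil I)))))))) =
      ap I d (tup I 1 fun e => ap I τ (tup I 1 fun t => ap I σ (tup I 1 fun s =>
        bintApp I (denP I (appendP A (W e t s)) (cons I X (nil I))) x y v))) := by
  simp only [← denP_caseOpen]
  rw [← denP_tupleR, ← denP_ax I A (ap I d _)]
  rfl

set_option maxRecDepth 4000 in
theorem bintApp_denP_recombP (W : Fin 2 → Fin 2 → Fin 2 → List (Fin 2)) (X : den I (bint A))
    (τ σ d : den I (boolF A)) (x y : den I (bang (endo A))) (v : den I A) :
    bintApp I (denP I (recombP A W) (cons I X (cons I τ (cons I σ (cons I d (nil I)))))) x y v =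
      ap I d (tup I 1 fun e => ap I τ (tup I 1 fun t => ap I σ (tup I 1 fun s =>
        bintApp I (denP I (appendP A (W e t s)) (cons I X (nil I))) x y v))) := by
  rw [← denP_recombOpen]
  rfl

end HeadTail

/-! ### Extension to linear combinations. -/

section Multilinearity

variable {k : Type u} [Field k] {At : Type v} (I : At → ModuleCat.{u} k)

theorem cons_sum_left {A : Formula At} {Γ : List (Formula At)} {ι : Type*} (s : Finset ι)
    (f : ι → den I A) (z : ctx I Γ) : cons I (∑ i ∈ s, f i) z = ∑ i ∈ s, cons I (f i) z :=
  TensorProduct.sum_tmul s f z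

theorem cons_sum_right {A : Formula At} {Γ : List (Formula At)} {ι : Type*} (s : Finset ι)
    (x : den I A) (f : ι → ctx I Γ) : cons I x (∑ i ∈ s, f i) = ∑ i ∈ s, cons I x (f i) :=
  TensorProduct.tmul_sum x s f

theorem cons_add_left {A : Formula At} {Γ : List (Formula At)} (x y : den I A) (z : ctx I Γ) :
    cons I (x + y) z = cons I x z + cons I y z :=
  TensorProduct.add_tmul x y z

theorem cons_add_right {A : Formula At} {Γ : List (Formula At)} (x : den I A) (y z : ctx I Γ) :
    cons I x (y + z) = cons I x y + cons I x z :=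
  TensorProduct.tmul_add x y z

theorem cons_smul_left {A : Formula At} {Γ : List (Formula At)} (c : k) (x : den I A)
    (z : ctx I Γ) : cons I (c • x) z = c • cons I x z :=
  TensorProduct.smul_tmul' c x z

theorem cons_smul_right {A : Formula At} {Γ : List (Formula At)} (c : k) (x : den I A)
    (z : ctx I Γ) : cons I x (c • z) = c • cons I x z :=
  TensorProduct.tmul_smul c x z

variable {A : Formula At} {n : ℕ} {s t r : ℕ}

theorem denP_tailP_sum (a : Fin s → k) (S : Fin s → List (Fin 2)) (σ : Fin s → Fin 2) :
    denP I (tailP A) (cons I (∑ i, a i • elt I (bintP (cube A) (S i ++ [σ i]))) (nil I)) =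
      ∑ i, a i • elt I (bintP A (S i)) := by
  simp only [cons_sum_left, cons_smul_left, map_sum, map_smul, denP_tailP]

theorem denP_headP_sum (a : Fin s → k) (S : Fin s → List (Fin 2)) (σ : Fin s → Fin 2) :
    denP I (headP A) (cons I (∑ i, a i • elt I (bintP (cube A) (S i ++ [σ i]))) (nil I)) =
      ∑ i, a i • elt I (nboolP A 1 (σ i)) := by
  simp only [cons_sum_left, cons_smul_left, map_sum, map_smul, denP_headP]

theorem denP_booltypeP_sum (c : Fin r → k) (q : Fin r → Fin (n + 1)) :
    denP I (booltypeP A n) (cons I (∑ i, c i • elt I (nboolP (cube A) n (q i))) (nil I)) =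
      ∑ i, c i • elt I (nboolP A n (q i)) := by
  simp only [cons_sum_left, cons_smul_left, map_sum, map_smul, denP_booltypeP]

theorem denP_transP_sum {m : ℕ} (f : Fin 2 → Fin (n + 1) → Fin (m + 1)) (a : Fin s → k)
    (σ : Fin s → Fin 2) (c : Fin r → k) (q : Fin r → Fin (n + 1)) :
    denP I (transP A f) (cons I (∑ i, a i • elt I (nboolP A 1 (σ i)))
      (cons I (∑ i, c i • elt I (nboolP A n (q i))) (nil I))) =
      ∑ i, ∑ j, (a i * c j) • elt I (nboolP A m (f (σ i) (q j))) := by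
  simp only [cons_sum_left, cons_smul_left, cons_sum_right, cons_smul_right, map_sum, map_smul,
    denP_transP, smul_smul, Finset.smul_sum, mul_comm (c _)]
  exact Finset.sum_comm

/-- The value of `transP f` on the last digit of `X` and the state `Y`. -/
def readP (f : Fin 2 → Fin (n + 1) → Fin 2) (X : den I (bint (cube A)))
    (Y : den I (nbool (cube A) n)) : den I (boolF A) :=
  denP I (transP A (m := 1) f) (cons I (denP I (headP A) (cons I X (nil I)))
    (cons I (denP I (booltypeP A n) (cons I Y (nil I))) (nil I)))

theorem denP_recombP (W : Fin 2 → Fin 2 → Fin 2 → List (Fin 2)) (S : List (Fin 2))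
    (τ σ d : Fin 2) :
    denP I (recombP A W) (cons I (elt I (bintP A S)) (cons I (elt I (nboolP A 1 τ))
      (cons I (elt I (nboolP A 1 σ)) (cons I (elt I (nboolP A 1 d)) (nil I))))) =
      elt I (bintP A (S ++ W d τ σ)) := by
  have h (i : Fin 2) (f : Fin 2 → den I A) : ap I (elt I (nboolP A 1 i)) (tup I 1 f) = f i := by
    rw [elt_nboolP]
    exact prj_tup I 1 f i
  refine bint_ext fun x y v => ?_
  rw [bintApp_denP_recombP, h, h, h, denP_appendP]

/-- The direction stays an unexpanded combination of the two booleans, so that its weights multiply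
whole branches; the other inputs are expanded. -/
theorem denP_recombP_sum (W : Fin 2 → Fin 2 → Fin 2 → List (Fin 2)) (p : Fin n → k)
    (S : Fin n → List (Fin 2)) (b : Fin t → k) (τ : Fin t → Fin 2) (a : Fin s → k)
    (c : Fin r → k) (σ : Fin s → Fin r → Fin 2) (w₀ w₁ : k) :
    denP I (recombP A W) (cons I (∑ i, p i • elt I (bintP A (S i)))
      (cons I (∑ m, b m • elt I (nboolP A 1 (τ m)))
        (cons I (∑ j, ∑ l, (a j * c l) • elt I (nboolP A 1 (σ j l)))
          (cons I (w₀ • elt I (nboolP A 1 0) + w₁ • elt I (nboolP A 1 1)) (nil I))))) =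
      w₀ • ∑ i, ∑ j, ∑ m, ∑ l,
          (p i * a j * b m * c l) • elt I (bintP A (S i ++ W 0 (τ m) (σ j l))) +
        w₁ • ∑ i, ∑ j, ∑ m, ∑ l,
          (p i * a j * b m * c l) • elt I (bintP A (S i ++ W 1 (τ m) (σ j l))) := by
  simp only [cons_add_left, cons_add_right, cons_smul_left, cons_smul_right, map_add, map_smul]
  have h (e : Fin 2) : denP I (recombP A W) (cons I (∑ i, p i • elt I (bintP A (S i)))
      (cons I (∑ m, b m • elt I (nboolP A 1 (τ m)))
        (cons I (∑ j, ∑ l, (a j * c l) • elt I (nboolP A 1 (σ j l)))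
          (cons I (elt I (nboolP A 1 e)) (nil I))))) =
      ∑ i, ∑ j, ∑ m, ∑ l,
          (p i * a j * b m * c l) • elt I (bintP A (S i ++ W e (τ m) (σ j l))) := by
    simp only [cons_sum_left, cons_smul_left, cons_sum_right, cons_smul_right, map_sum, map_smul,
      denP_recombP, smul_smul, Finset.smul_sum]
    refine (Finset.sum_congr rfl fun j _ => (Finset.sum_congr rfl fun l _ =>
      Finset.sum_comm).trans (Finset.sum_comm.trans (Finset.sum_congr rfl fun i _ =>
        Finset.sum_comm))).trans (Finset.sum_comm.trans ?_)
    refine Finset.sum_congr rfl fun i _ => Finset.sum_congr rfl fun j _ =>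
      Finset.sum_congr rfl fun m _ => Finset.sum_congr rfl fun l _ => ?_
    congr 1
    ring
  rw [h, h]

/-- Used for the branch with empty appended word, where symbol and state indices affect only the
coefficients. -/
theorem sum_mul_smul_eq {M : Type*} [AddCommGroup M] [Module k M] (p : Fin n → k)
    (a : Fin s → k) (b : Fin t → k) (c : Fin r → k) (e : Fin n → M) :
    ∑ i, ∑ j, ∑ m, ∑ l, (p i * a j * b m * c l) • e i =
      ((∑ j, a j) * (∑ m, b m) * (∑ l, c l)) • ∑ i, p i • e i := by
  simp only [← Finset.sum_smul, Finset.smul_sum, smul_smul, ← Finset.mul_sum, ← Finset.sum_mul]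
  refine Finset.sum_congr rfl fun i _ => ?_
  congr 1
  ring

theorem trans₂_sum (δ : TransitionFunction n) (a : Fin s → k) (σ : Fin s → Fin 2)
    (c : Fin r → k) (q : Fin r → Fin (n + 1)) :
    ∑ i, ∑ j, (a i * c j) • elt I (nboolP A 1 (δ (σ i, q j)).2.2.toFin) =
      (∑ i, ∑ j, a i * c j * (if (δ (σ i, q j)).2.2 = Dir.left then 1 else 0)) •
          elt I (nboolP A 1 0) +
        (∑ i, ∑ j, a i * c j * (if (δ (σ i, q j)).2.2 = Dir.right then 1 else 0)) •
          elt I (nboolP A 1 1) := by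
  simp only [Finset.sum_smul, ← Finset.sum_add_distrib]
  refine Finset.sum_congr rfl fun i _ => Finset.sum_congr rfl fun j _ => ?_
  cases (δ (σ i, q j)).2.2 <;> simp [Dir.toFin]

variable (δ : TransitionFunction n)

-- This records where each copy goes: `X₁` to the tail, `Y` to the neighbouring symbol, `X₂` with
-- `Z₁` to the written symbol, `X₃` with `Z₂` to the direction. The axioms reinserted on the right
-- are those of `middleP`.
set_option maxRecDepth 4000 in
theorem denP_leftP (X₁ X₂ X₃ Y : den I (bint (cube A))) (Z₁ Z₂ : den I (nbool (cube A) n)) :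
    denP I (leftP δ A) (cons I X₁ (cons I X₂ (cons I X₃ (cons I Y (cons I Z₁ (cons I Z₂
      (nil I))))))) =
    denP I (recomb₀ A) (cons I (denP I (tailP A) (cons I X₁ (nil I)))
      (cons I (denP I (headP A) (cons I Y (nil I)))
        (cons I (readP I (fun σ q => (δ (σ, q)).1) X₂ Z₁)
          (cons I (readP I (fun σ q => (δ (σ, q)).2.2.toFin) X₃ Z₂) (nil I))))) := by
  conv_rhs => rw [← denP_ax I _ (denP I (tailP A) _), ← denP_ax I _ (denP I (headP A) _)]
  rfl

set_option maxRecDepth 4000 in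
theorem denP_rightP (X₁ X₂ Y₁ Y₂ : den I (bint (cube A))) (Z₁ Z₂ : den I (nbool (cube A) n)) :
    denP I (rightP δ A) (cons I X₁ (cons I X₂ (cons I Y₁ (cons I Y₂ (cons I Z₁ (cons I Z₂
      (nil I))))))) =
    denP I (recomb₁ A) (cons I (denP I (tailP A) (cons I Y₂ (nil I)))
      (cons I (denP I (headP A) (cons I Y₁ (nil I)))
        (cons I (readP I (fun σ q => (δ (σ, q)).1) X₁ Z₁)
          (cons I (readP I (fun σ q => (δ (σ, q)).2.2.toFin) X₂ Z₂) (nil I))))) := by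
  conv_rhs => rw [← denP_ax I _ (denP I (tailP A) _), ← denP_ax I _ (denP I (headP A) _)]
  rfl

theorem denP_stateP (X : den I (bint (cube A))) (Z : den I (nbool (cube A) n)) :
    denP I (stateP δ A) (cons I X (cons I Z (nil I))) =
      denP I (trans₁ δ A) (cons I (denP I (headP A) (cons I X (nil I)))
        (cons I (denP I (booltypeP A n) (cons I Z (nil I))) (nil I))) := rfl

end Multilinearity

/-! ### The step function on vacuum vectors. -/

section Step

variable {k : Type u} [Field k] {At : Type v} (I : At → ModuleCat.{u} k)

theorem move_app {A : Formula At} {Δ : List (Formula At)} (Γ : List (Formula At)) (g : Env I Γ)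
    (x : den I A) (z : ctx I Δ) :
    move I A Γ Δ (cons I x (app I Γ g z)) = app I Γ g (cons I x z) := by
  induction Γ with
  | nil => rfl
  | cons B Γ ih => exact congrArg (cons I g.1) (ih g.2)

theorem denP_exch {A C : Formula At} {Δ : List (Formula At)} (Υ Γ : List (Formula At))
    (π : Prf (Υ ++ (Γ ++ A :: Δ)) C) (e : Env I Υ) (g : Env I Γ) (x : den I A) (z : ctx I Δ) :
    denP I (.exch Υ Γ π) (app I Υ e (cons I x (app I Γ g z))) =
      denP I π (app I Υ e (app I Γ g (cons I x z))) := by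
  rw [← move_app I Γ g x z]
  exact congrArg (denP I π) (under_app I (move I A Γ Δ) Υ e _)

/-- The contraction, on the left, of a proof in the context of the three components of `stepP`
to three formulas. -/
def contractP {B N C : Formula At} (π : Prf [bang B, bang B, bang B, bang B, bang N, bang N,
    bang B, bang B, bang B, bang B, bang N, bang N, bang B, bang N] C) :
    Prf [bang B, bang B, bang N] C :=
  let S := bang B
  let Q := bang N
  .ctr [S, S] (Δ := []) (.ctr [] (Δ := [S, Q, Q]) (.exch [S] [S, Q] (A := S) (Δ := [Q])
    (.ctr [S, S] (Δ := [S, Q]) (.ctr [S] (Δ := [Q, Q, S, Q])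
      (.exch [S, S] [Q] (A := S) (Δ := [Q, S, Q])
        (.ctr [] (Δ := [S, Q, S, Q, S, Q]) (.exch [S] [S, Q] (A := S) (Δ := [S, Q, S, Q])
          (.ctr [S, S, Q, S, S] (Δ := [S, Q]) (.ctr [S, S, Q, S] (Δ := [Q, Q, S, Q])
            (.ctr [S, S, Q] (Δ := [S, S, Q, Q, S, Q])
              (.ctr [S, S] (Δ := [S, S, S, S, Q, Q, S, Q])
                (.ctr [] (Δ := [S, Q, Q, S, S, S, S, Q, Q, S, Q])
                  (.ctr [] (Δ := [S, S, Q, Q, S, S, S, S, Q, Q, S, Q]) π)))))))))))))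

theorem denP_contractP {B N C : Formula At} (π : Prf [bang B, bang B, bang B, bang B, bang N,
      bang N, bang B, bang B, bang B, bang B, bang N, bang N, bang B, bang N] C)
    (α β : den I B) (γ : den I N) :
    denP I (contractP π) (cons I (vacuum I α) (cons I (vacuum I β)
        (cons I (vacuum I γ) (nil I)))) =
      denP I π (cons I (vacuum I α) (cons I (vacuum I α) (cons I (vacuum I α)
        (cons I (vacuum I β) (cons I (vacuum I γ) (cons I (vacuum I γ)
        (cons I (vacuum I α) (cons I (vacuum I α) (cons I (vacuum I β)
        (cons I (vacuum I β) (cons I (vacuum I γ) (cons I (vacuum I γ)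
        (cons I (vacuum I α) (cons I (vacuum I γ) (nil I))))))))))))))) := by
  unfold contractP
  dsimp only
  -- From here on only one property of these vectors matters: contraction duplicates them.
  generalize ha : vacuum I α = a
  generalize hb : vacuum I β = b
  generalize hc : vacuum I γ = c
  have hα {C : Formula At} {Δ : List (Formula At)} (Υ : List (Formula At))
      (π : Prf (Υ ++ bang B :: bang B :: Δ) C) (e : Env I Υ) (z : ctx I Δ) :
      denP I (.ctr Υ π) (app I Υ e (cons I a z)) =
        denP I π (app I Υ e (cons I a (cons I a z))) := ha ▸ denP_ctr_vacuum I Υ π e α z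
  have hβ {C : Formula At} {Δ : List (Formula At)} (Υ : List (Formula At))
      (π : Prf (Υ ++ bang B :: bang B :: Δ) C) (e : Env I Υ) (z : ctx I Δ) :
      denP I (.ctr Υ π) (app I Υ e (cons I b z)) =
        denP I π (app I Υ e (cons I b (cons I b z))) := hb ▸ denP_ctr_vacuum I Υ π e β z
  have hγ {C : Formula At} {Δ : List (Formula At)} (Υ : List (Formula At))
      (π : Prf (Υ ++ bang N :: bang N :: Δ) C) (e : Env I Υ) (z : ctx I Δ) :
      denP I (.ctr Υ π) (app I Υ e (cons I c z)) =
        denP I π (app I Υ e (cons I c (cons I c z))) := hc ▸ denP_ctr_vacuum I Υ π e γ z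
  -- The structural rules are read from the conclusion upwards; each tuple lists the factors to the
  -- left of the principal formula or in the block it crosses.
  refine (hγ [_, _] _ (a, b, ⟨⟩) (nil I)).trans ?_
  refine (hα [] _ ⟨⟩ (cons I b (cons I c (cons I c (nil I))))).trans ?_
  refine (denP_exch I [_] [_, _] _ (a, ⟨⟩) (b, c, ⟨⟩) a (cons I c (nil I))).trans ?_
  refine (hγ [_, _] _ (a, b, ⟨⟩) (cons I a (cons I c (nil I)))).trans ?_
  refine (hβ [_] _ (a, ⟨⟩) (cons I c (cons I c (cons I a (cons I c (nil I)))))).trans ?_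
  refine (denP_exch I [_, _] [_] _ (a, b, ⟨⟩) (c, ⟨⟩) b
    (cons I c (cons I a (cons I c (nil I))))).trans ?_
  refine (hα [] _ ⟨⟩ (cons I b (cons I c (cons I b
    (cons I c (cons I a (cons I c (nil I)))))))).trans ?_
  refine (denP_exch I [_] [_, _] _ (a, ⟨⟩) (b, c, ⟨⟩) a (cons I b
    (cons I c (cons I a (cons I c (nil I)))))).trans ?_
  refine (hγ [_, _, _, _, _] _ (a, b, c, a, b, ⟨⟩) (cons I a (cons I c (nil I)))).trans ?_
  refine (hβ [_, _, _, _] _ (a, b, c, a, ⟨⟩) (cons I c (cons I c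
    (cons I a (cons I c (nil I)))))).trans ?_
  refine (hα [_, _, _] _ (a, b, c, ⟨⟩) (cons I b (cons I b (cons I c (cons I c
    (cons I a (cons I c (nil I)))))))).trans ?_
  refine (hγ [_, _] _ (a, b, ⟨⟩) (cons I a (cons I a (cons I b (cons I b (cons I c (cons I c
    (cons I a (cons I c (nil I)))))))))).trans ?_
  refine (hα [] _ ⟨⟩ _).trans ?_
  exact hα [] _ ⟨⟩ _

/-- The universal map `!A → A`. -/
def dBang {A : Formula At} (x : den I (bang A)) : den I A := Cofree.d (k := k) (V := den I A) x

theorem dBang_vacuum {A : Formula At} (x : den I A) : dBang I (vacuum I x) = x :=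
  Cofree.d_vac x

/-- Dereliction on all inputs. -/
def der₆ {B N C : Formula At} (π : Prf [B, B, B, B, N, N] C) :
    Prf [bang B, bang B, bang B, bang B, bang N, bang N] C :=
  let S := bang B
  let Q := bang N
  .der [] (Δ := [S, S, S, Q, Q]) (.der [B] (Δ := [S, S, Q, Q]) (.der [B, B] (Δ := [S, Q, Q])
    (.der [B, B, B] (Δ := [Q, Q]) (.der [B, B, B, B] (Δ := [Q])
      (.der [B, B, B, B, N] (Δ := []) π)))))

/-- Dereliction on both inputs. -/
def der₂ {B N C : Formula At} (π : Prf [B, N] C) : Prf [bang B, bang N] C :=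
  .der [] (Δ := [bang N]) (.der [B] (Δ := []) π)

theorem denP_prom_der₆ {B N C : Formula At} (π : Prf [B, B, B, B, N, N] C)
    (x₁ x₂ x₃ x₄ : den I B) (y₁ y₂ : den I N) :
    denP I (.prom [B, B, B, B, N, N] (der₆ π)) (cons I (vacuum I x₁) (cons I (vacuum I x₂)
      (cons I (vacuum I x₃) (cons I (vacuum I x₄) (cons I (vacuum I y₁) (cons I (vacuum I y₂)
        (nil I))))))) =
      vacuum I (denP I π (cons I x₁ (cons I x₂ (cons I x₃ (cons I x₄ (cons I y₁ (cons I y₂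
        (nil I)))))))) := by
  refine (denP_prom I [B, B, B, B, N, N] (der₆ π)
    (isGroupLikeElem_cons (Γ := [B, B, B, N, N]) I x₁
      (isGroupLikeElem_cons (Γ := [B, B, N, N]) I x₂
        (isGroupLikeElem_cons (Γ := [B, N, N]) I x₃ (isGroupLikeElem_cons (Γ := [N, N]) I x₄
          (isGroupLikeElem_cons (Γ := [N]) I y₁
            (isGroupLikeElem_cons (Γ := []) I y₂ (isGroupLikeElem_nil I)))))))).trans ?_
  -- Each input is written as the dereliction of its vacuum, which is what the left side computes
  -- to.
  conv_rhs => rw [← dBang_vacuum I x₁, ← dBang_vacuum I x₂, ← dBang_vacuum I x₃,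
    ← dBang_vacuum I x₄, ← dBang_vacuum I y₁, ← dBang_vacuum I y₂]
  rfl

theorem denP_prom_der₂ {B N C : Formula At} (π : Prf [B, N] C) (x : den I B) (y : den I N) :
    denP I (.prom [B, N] (der₂ π)) (cons I (vacuum I x) (cons I (vacuum I y) (nil I))) =
      vacuum I (denP I π (cons I x (cons I y (nil I)))) := by
  refine (denP_prom I [B, N] (der₂ π) (isGroupLikeElem_cons (Γ := [N]) I x
    (isGroupLikeElem_cons (Γ := []) I y (isGroupLikeElem_nil I)))).trans ?_
  conv_rhs => rw [← dBang_vacuum I x, ← dBang_vacuum I y]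
  rfl

theorem denP_tensorL_tensorL {A B C D : Formula At} (π : Prf [A, B, C] D) (x : den I A)
    (y : den I B) (z : den I C) :
    denP I (.tensorL [] (Δ := []) (.tensorL [A] (Δ := []) π))
      (cons I (pair I x (pair I y z)) (nil I)) =
      denP I π (cons I x (cons I y (cons I z (nil I)))) := rfl

set_option maxRecDepth 4000 in
theorem denP_stepP {A : Formula At} {n : ℕ} (δ : TransitionFunction n)
    (α β : den I (bint (cube A))) (γ : den I (nbool (cube A) n)) :
    denP I (stepP δ A)
        (cons I (pair I (vacuum I α) (pair I (vacuum I β) (vacuum I γ))) (nil I)) =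
      pair I (vacuum I (denP I (leftP δ A)
          (cons I α (cons I α (cons I α (cons I β (cons I γ (cons I γ (nil I)))))))))
        (pair I (vacuum I (denP I (rightP δ A)
          (cons I α (cons I α (cons I β (cons I β (cons I γ (cons I γ (nil I)))))))))
          (vacuum I (denP I (stateP δ A) (cons I α (cons I γ (nil I)))))) := by
  let S := bang (bint (cube A))
  let Q := bang (nbool (cube A) n)
  have h : stepP δ A = .tensorL [] (Δ := []) (.tensorL [S] (Δ := []) (contractP
    (.tensorR (Γ := [S, S, S, S, Q, Q]) (Δ := [S, S, S, S, Q, Q, S, Q])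
      (.prom [_, _, _, _, _, _] (der₆ (leftP δ A)))
      (.tensorR (Γ := [S, S, S, S, Q, Q]) (Δ := [S, Q])
        (.prom [_, _, _, _, _, _] (der₆ (rightP δ A)))
        (.prom [_, _] (der₂ (stateP δ A))))))) := rfl
  rw [h]
  refine (denP_tensorL_tensorL I _ _ _ _).trans ((denP_contractP I _ α β γ).trans ?_)
  rw [← denP_prom_der₆, ← denP_prom_der₆, ← denP_prom_der₂]
  rfl

end Step

end Sweedler

end

/-! ### Assembly of the four equations. -/

theorem mainTheorem4 {k : Type u} [Field k] [IsAlgClosed k] {At : Type v}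
    (I : At → ModuleCat.{u} k) (A : Formula At) {n : ℕ} (δ : TransitionFunction n)
    {s t r : ℕ}
    (a : Fin s → k) (S : Fin s → List (Fin 2)) (σ : Fin s → Fin 2)
    (b : Fin t → k) (T : Fin t → List (Fin 2)) (τ : Fin t → Fin 2)
    (c : Fin r → k) (q : Fin r → Fin (n + 1)) :
    let α : den I (bint (cube A)) := ∑ i, a i • elt I (bintP (cube A) (S i ++ [σ i]))
    let β : den I (bint (cube A)) := ∑ i, b i • elt I (bintP (cube A) (T i ++ [τ i]))
    let γ : den I (nbool (cube A) n) := ∑ i, c i • elt I (nboolP (cube A) n (q i))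
    let σ' : Fin s → Fin r → Fin 2 := fun i j => (δ (σ i, q j)).1
    let q' : Fin s → Fin r → Fin (n + 1) := fun i j => (δ (σ i, q j)).2.1
    let d' : Fin s → Fin r → Dir := fun i j => (δ (σ i, q j)).2.2
    let wL : k := ∑ i, ∑ j, a i * c j * (if d' i j = Dir.left then 1 else 0)
    let wR : k := ∑ i, ∑ j, a i * c j * (if d' i j = Dir.right then 1 else 0)
    let leftVec : den I (bint A) :=
      (wL * (∑ i, a i) * (∑ i, b i) * (∑ i, c i)) • (∑ i, a i • elt I (bintP A (S i))) +
        wR • ∑ i, ∑ j, ∑ m, ∑ l,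
          (a i * a j * b m * c l) • elt I (bintP A (S i ++ [σ' j l, τ m]))
    let rightVec : den I (bint A) :=
      (wR * (∑ i, a i) * (∑ i, b i) * (∑ i, c i)) • (∑ i, b i • elt I (bintP A (T i))) +
        wL • ∑ i, ∑ j, ∑ m, ∑ l,
          (b i * a j * b m * c l) • elt I (bintP A (T i ++ [τ m, σ' j l]))
    let stateVec : den I (nbool A n) :=
      ∑ i, ∑ j, (a i * c j) • elt I (nboolP A n (q' i j))
    denP I (leftP δ A) (cons I α (cons I α (cons I α (cons I β (cons I γ (cons I γ (nil I))))))) =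
        leftVec ∧
      denP I (rightP δ A)
          (cons I α (cons I α (cons I β (cons I β (cons I γ (cons I γ (nil I))))))) = rightVec ∧
      denP I (stateP δ A) (cons I α (cons I γ (nil I))) = stateVec ∧
      denP I (stepP δ A)
          (cons I (pair I (vacuum I α) (pair I (vacuum I β) (vacuum I γ))) (nil I)) =
        pair I (vacuum I leftVec) (pair I (vacuum I rightVec) (vacuum I stateVec)) := by
  intro α β γ σ' q' d' wL wR leftVec rightVec stateVec
  have hread₀ : readP I (fun σ q => (δ (σ, q)).1) α γ =
      ∑ j, ∑ l, (a j * c l) • elt I (nboolP A 1 (σ' j l)) := by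
    rw [readP, denP_headP_sum, denP_booltypeP_sum, denP_transP_sum]
  have hread₂ : readP I (fun σ q => (δ (σ, q)).2.2.toFin) α γ =
      wL • elt I (nboolP A 1 0) + wR • elt I (nboolP A 1 1) := by
    rw [readP, denP_headP_sum, denP_booltypeP_sum, denP_transP_sum, trans₂_sum]
  have hleft : denP I (leftP δ A)
      (cons I α (cons I α (cons I α (cons I β (cons I γ (cons I γ (nil I))))))) = leftVec := by
    rw [denP_leftP, hread₀, hread₂, denP_tailP_sum, denP_headP_sum, recomb₀, denP_recombP_sum]
    -- For direction `0` nothing is appended, so the first sum factors; direction `1` appends the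
    -- two symbols.
    simp only [if_true, if_neg (one_ne_zero : (1 : Fin 2) ≠ 0), List.append_nil]
    rw [sum_mul_smul_eq, smul_smul]
    simp only [leftVec, mul_assoc]
  have hright : denP I (rightP δ A)
      (cons I α (cons I α (cons I β (cons I β (cons I γ (cons I γ (nil I))))))) = rightVec := by
    rw [denP_rightP, hread₀, hread₂, denP_tailP_sum, denP_headP_sum, recomb₁, denP_recombP_sum]
    simp only [if_true, if_neg (one_ne_zero : (1 : Fin 2) ≠ 0), List.append_nil]
    -- Here direction `1` is the branch that appends nothing, and its term is written first in
    -- `rightVec`.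
    rw [sum_mul_smul_eq, smul_smul, add_comm]
    simp only [rightVec, mul_assoc]
  have hstate : denP I (stateP δ A) (cons I α (cons I γ (nil I))) = stateVec := by
    rw [denP_stateP, denP_headP_sum, denP_booltypeP_sum, trans₁, denP_transP_sum]
  exact ⟨hleft, hright, hstate, by rw [denP_stepP, hleft, hright, hstate]⟩
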